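/- Let $\Lambda=(-1,1)$. For $\rho>0$ let $$I^{\rho}_{-}v(x)=\frac1{\Gamma(\rho)}\int_{-1}^{x}\frac{v(t)}{(x-t)^{1-\rho}}\,dt,\qquad I^{\rho}_{+}v(x)=\frac1{\Gamma(\rho)}\int_{x}^{1}\frac{v(t)}{(t-x)^{1-\rho}}\,dt .$$ For $s\in[m-1,m)$, $m\in\mathbb N$, the Riesz fractional derivative of order $s$ on $\Lambda$ is $$D^{s}v(x)=\frac{(-1)^{\lfloor (s+1)/2\rfloor}}{2\cos(\pi s/2)}\left[\frac{d^m}{dx^m}I_{-}^{m-s}v(x)+(-1)^m\frac{d^m}{dx^m}I_{+}^{m-s}v(x)\right],\qquad x\in\Lambda,$$ and, when $s$ is an odd integer (so that $\cos(\pi s/2)=0$), $D^{s}v(x)=\lim_{r\downarrow s}D^{r}v(x)$. For $n\in\mathbb N_0$ and arbitrary real $a,b$ let $P_n^{a,b}$ be the Jacobi polynomial $$P_n^{a,b}(x)=\sum_{m=0}^{n}\frac{(n+a+b+1)_m\,(a+m+1)_{n-m}}{m!\,(n-m)!}\Big(\frac{x-1}{2}\Big)^m,\qquad (c)_m=c(c+1)\cdots(c+m-1).$$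 Let $\alpha>0$, let $k\in\mathbb N_0$ satisfy $2\alpha\in[2k-1,2k+1)$, and let $\nu\in\{0,1,\dots,\lfloor\alpha\rfloor\}$. Let $\mathcal J_n^{-\alpha,-\alpha}(x)=(1-x^2)^{\alpha}P_n^{\alpha,\alpha}(x)$. Then for every $n\in\mathbb N_0$ and every $x\in\Lambda$ the Riesz derivative $D^{2\alpha-2\nu}\mathcal J_n^{-\alpha,-\alpha}(x)$ exists and $$D^{2\alpha-2\nu}\mathcal J_n^{-\alpha,-\alpha}(x)=(-1)^{k}\,\frac{2^{2\nu}\,\Gamma(n+2\alpha-2\nu+1)}{n!}\,P_{n+2\nu}^{\alpha-2\nu,\alpha-2\nu}(x).$$ -/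

import Mathlib

open Set Filter Topology MeasureTheory

noncomputable section

namespace RieszJacobi

/-- The Jacobi polynomial `P_n^{a,b}` for arbitrary real parameters `a, b`:
`∑_{m ≤ n} (n+a+b+1)_m (a+m+1)_{n-m} / (m! (n-m)!) * ((x-1)/2)^m`,
where `(c)_m = c (c+1) ⋯ (c+m-1)` is the rising factorial. For `a, b > -1` these are the classical
Jacobi polynomials in the standard normalization `P_n^{a,b}(1) = (a+1)_n / n!`; the coefficients
are polynomials in `a, b`, so the formula is also the usual extension to all parameters. -/
def jacobiP (n : ℕ) (a b x : ℝ) : ℝ :=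
  ∑ m ∈ Finset.range (n + 1),
    (ascPochhammer ℝ m).eval ((n : ℝ) + a + b + 1) *
      (ascPochhammer ℝ (n - m)).eval (a + (m : ℝ) + 1) /
        ((m.factorial : ℝ) * ((n - m).factorial : ℝ)) * ((x - 1) / 2) ^ m

/-- The generalized Jacobi function `(1 - x²)^α P_n^{α,α}(x)` on `(-1, 1)`. -/
def genJacobi (n : ℕ) (α x : ℝ) : ℝ :=
  (1 - x ^ 2) ^ α * jacobiP n α α x

/-- The integrand `v(t) / (x - t)^{1-ρ}` of the left fractional integral. -/
def leftKernel (ρ : ℝ) (v : ℝ → ℝ) (x t : ℝ) : ℝ := v t / (x - t) ^ (1 - ρ)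

/-- The integrand `v(t) / (t - x)^{1-ρ}` of the right fractional integral. -/
def rightKernel (ρ : ℝ) (v : ℝ → ℝ) (x t : ℝ) : ℝ := v t / (t - x) ^ (1 - ρ)

/-- The left Riemann–Liouville fractional integral of order `ρ > 0` on `(-1, 1)`. -/
def leftFracInt (ρ : ℝ) (v : ℝ → ℝ) (x : ℝ) : ℝ :=
  1 / Real.Gamma ρ * ∫ t in (-1 : ℝ)..x, leftKernel ρ v x t

/-- The right Riemann–Liouville fractional integral of order `ρ > 0` on `(-1, 1)`. -/
def rightFracInt (ρ : ℝ) (v : ℝ → ℝ) (x : ℝ) : ℝ :=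
  1 / Real.Gamma ρ * ∫ t in x..(1 : ℝ), rightKernel ρ v x t

/-- For `s ≥ 0`, the positive integer `k` with `s ∈ [k - 1, k)`. -/
def ceilOrder (s : ℝ) : ℕ := ⌊s⌋₊ + 1

/-- The left Riemann–Liouville fractional derivative of order `s ≥ 0` on `(-1, 1)`. -/
def leftRL (s : ℝ) (v : ℝ → ℝ) (x : ℝ) : ℝ :=
  iteratedDeriv (ceilOrder s) (leftFracInt ((ceilOrder s : ℝ) - s) v) x

/-- The right Riemann–Liouville fractional derivative of order `s ≥ 0` on `(-1, 1)`. -/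
def rightRL (s : ℝ) (v : ℝ → ℝ) (x : ℝ) : ℝ :=
  (-1) ^ ceilOrder s * iteratedDeriv (ceilOrder s) (rightFracInt ((ceilOrder s : ℝ) - s) v) x

/-- The two Riemann–Liouville derivatives of order `s` of `v` genuinely exist at `x`: the
fractional integrals converge on `(-1, 1)` and are `k` times continuously differentiable near `x`.
This keeps the junk values of integrals and derivatives out of the Riesz derivative. -/
def RLDefinedAt (s : ℝ) (v : ℝ → ℝ) (x : ℝ) : Prop :=
  (∀ y ∈ Ioo (-1 : ℝ) 1,
    IntervalIntegrable (leftKernel ((ceilOrder s : ℝ) - s) v y) volume (-1) y ∧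
    IntervalIntegrable (rightKernel ((ceilOrder s : ℝ) - s) v y) volume y 1) ∧
  ContDiffAt ℝ (ceilOrder s : ℕ) (leftFracInt ((ceilOrder s : ℝ) - s) v) x ∧
  ContDiffAt ℝ (ceilOrder s : ℕ) (rightFracInt ((ceilOrder s : ℝ) - s) v) x

/-- The expression `(-1)^⌊(s+1)/2⌋ / (2 cos (π s / 2)) * (left + right derivative)`; it is
meaningful when `s ≥ 0` is not an odd integer. -/
def rieszExpr (s : ℝ) (v : ℝ → ℝ) (x : ℝ) : ℝ :=
  (-1) ^ ⌊(s + 1) / 2⌋₊ / (2 * Real.cos (Real.pi * s / 2)) * (leftRL s v x + rightRL s v x)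

/-- `s` is an odd positive integer. -/
def IsOddOrder (s : ℝ) : Prop := ∃ m : ℕ, s = 2 * (m : ℝ) + 1

/-- `HasRieszDerivAt s v x d`: the Riesz fractional derivative `D^s v (x)` of order `s ≥ 0` on
`(-1, 1)` exists and equals `d`. If `s` is an odd integer, where `cos (π s / 2) = 0`, it is the
limit of `D^r v (x)` as `r` decreases to `s`; the limit is one-sided because the sign
`(-1)^⌊(r+1)/2⌋` is only right-continuous at odd integers. -/
def HasRieszDerivAt (s : ℝ) (v : ℝ → ℝ) (x d : ℝ) : Prop :=
  (¬ IsOddOrder s → RLDefinedAt s v x ∧ rieszExpr s v x = d) ∧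
  (IsOddOrder s → (∀ᶠ r in 𝓝[>] s, RLDefinedAt r v x) ∧
    Tendsto (fun r => rieszExpr r v x) (𝓝[>] s) (𝓝 d))

end RieszJacobi

end

noncomputable section

namespace RieszJacobi

/-! Rodrigues' formula makes `(1 - x²)^α P_n^{α,α}` a constant times the `n`-th derivative of the
weight `w = (1 - x²)^β`, `β = α + n`. All functions differentiated on the way vanish at the
endpoints, so fractional integration commutes with these derivatives (`rlInt_genJacobi`). The
reflection `x ↦ -x` exchanges left and right integrals. Hence the Riesz derivative of order `r`
comes from differentiating the even potential `ℓ(x) + ℓ(-x)`, where `ℓ` is the left integral of `w`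
of an order `ρ = 2h - r > 2`.

Integrals of `w` of three consecutive orders satisfy a linear relation (`rlInt_weight_recurrence`),
which is a second-order ODE for the potential. An even solution is fixed by its value at `0`, here a
Beta integral, so the potential is an explicit multiple of a hypergeometric series in `x²`
(`rieszPotential_weight`). As an exponential generating function, the series is differentiated by
shifting its coefficients. This gives the derivative for every order that is not an odd integer
(`rieszExpr_genJacobi`). The reflection and duplication formulas for Gamma cancel the cosine
(`riesz_constant`), so apart from the sign the result is continuous in `r`; the sign is constant
just to the right of each order, and odd orders follow by a limit.

At `r = 2α - 2ν` one parameter is `-2(n + ν)` and the series terminates. By ODE uniqueness it is a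
multiple of `P_{2(n+ν)}^{a,a}` with `a = α - 2ν - n`, whose `n`-th derivative is a multiple of
`P_{n+2ν}^{α-2ν,α-2ν}` (`egf_hyperSeq_terminating`). The value of `P_{2(n+ν)}^{a,a}` at `0` supplies
the factor `(-1)^ν` that turns `(-1)^(k-ν)` into `(-1)^k`. -/

/-! ### Ultraspherical polynomials with arbitrary real parameter -/

lemma ascPochhammer_eval_succ_left (c : ℝ) (n : ℕ) :
    (ascPochhammer ℝ (n + 1)).eval c = c * (ascPochhammer ℝ n).eval (c + 1) := by
  simp [ascPochhammer_succ_left, Polynomial.eval_comp]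

lemma ascPochhammer_eval_succ_right (c : ℝ) (n : ℕ) :
    (ascPochhammer ℝ (n + 1)).eval c = (ascPochhammer ℝ n).eval c * (c + n) :=
  ascPochhammer_succ_eval n c

/-- The coefficient of `((x - 1) / 2) ^ m` in the ultraspherical polynomial `P_n^{a,a}`. -/
def ultraCoeff (n : ℕ) (a : ℝ) (m : ℕ) : ℝ :=
  (ascPochhammer ℝ m).eval ((n : ℝ) + a + a + 1) *
      (ascPochhammer ℝ (n - m)).eval (a + (m : ℝ) + 1) /
        ((m.factorial : ℝ) * ((n - m).factorial : ℝ))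

lemma jacobiP_eq_sum (n : ℕ) (a x : ℝ) :
    jacobiP n a a x = ∑ m ∈ Finset.range (n + 1), ultraCoeff n a m * ((x - 1) / 2) ^ m := rfl

lemma jacobiP_zero (a b x : ℝ) : jacobiP 0 a b x = 1 := by
  simp [jacobiP]

lemma ultraCoeff_succ_succ (n : ℕ) (a : ℝ) (m : ℕ) :
    ((m : ℝ) + 1) * ultraCoeff (n + 1) a (m + 1) =
      ((n : ℝ) + 2 * a + 2) * ultraCoeff n (a + 1) m := by
  unfold ultraCoeff
  rw [ascPochhammer_eval_succ_left, Nat.factorial_succ, Nat.add_sub_add_right]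
  push_cast
  rw [show (n : ℝ) + 1 + a + a + 1 + 1 = n + (a + 1) + (a + 1) + 1 by ring,
    show a + ((m : ℝ) + 1) + 1 = a + 1 + m + 1 by ring]
  have h1 : ((m.factorial : ℝ)) ≠ 0 := by positivity
  have h2 : (((n - m).factorial : ℝ)) ≠ 0 := by positivity
  field_simp
  ring

lemma hasDerivAt_jacobiP_sum (n : ℕ) (a x : ℝ) :
    HasDerivAt (jacobiP n a a)
      (∑ m ∈ Finset.range (n + 1), ultraCoeff n a m * (m * ((x - 1) / 2) ^ (m - 1) * (1 / 2))) x := by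
  have h : HasDerivAt (fun x : ℝ => (x - 1) / 2) (1 / 2) x :=
    ((hasDerivAt_id x).sub_const 1).div_const 2
  exact HasDerivAt.fun_sum fun m _ => (h.pow m).const_mul _

lemma hasDerivAt_jacobiP_succ (n : ℕ) (a x : ℝ) :
    HasDerivAt (jacobiP (n + 1) a a)
      (((n : ℝ) + 2 * a + 2) / 2 * jacobiP n (a + 1) (a + 1) x) x := by
  convert hasDerivAt_jacobiP_sum (n + 1) a x using 1
  rw [Finset.sum_range_succ', jacobiP_eq_sum, Finset.mul_sum]
  simp only [Nat.cast_zero, zero_mul, mul_zero, add_zero]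
  refine Finset.sum_congr rfl fun m _ => ?_
  have := ultraCoeff_succ_succ n a m
  push_cast
  linear_combination (-1 / 2 * ((x - 1) / 2) ^ m) * this

lemma contDiff_jacobiP (n : ℕ) (a b : ℝ) {N : WithTop ℕ∞} : ContDiff ℝ N (jacobiP n a b) := by
  unfold jacobiP
  fun_prop

/-- Comparison of inner coefficients in the raising identity, expanded in `y = (x - 1) / 2`; the
next two lemmas treat the constant and the leading coefficient. -/
lemma ultraCoeff_shift (n : ℕ) (a : ℝ) (m : ℕ) (hm : m + 1 ≤ n) :
    ((n : ℝ) + 1) * ultraCoeff (n + 1) a (m + 1) =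
      ((m : ℝ) + 1 + a + 1) * ultraCoeff n (a + 1) (m + 1) +
        ((m : ℝ) + 2 * a + 2) * ultraCoeff n (a + 1) m := by
  obtain ⟨d, rfl⟩ := Nat.exists_eq_add_of_le hm
  unfold ultraCoeff
  rw [show m + 1 + d + 1 - (m + 1) = d + 1 by omega, show m + 1 + d - (m + 1) = d by omega,
    show m + 1 + d - m = d + 1 by omega]
  push_cast
  rw [ascPochhammer_eval_succ_left (((m : ℝ) + 1 + d + 1 + a + a + 1)),
    ascPochhammer_eval_succ_right _ m, ascPochhammer_eval_succ_left _ d,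
    ascPochhammer_eval_succ_left _ d, Nat.factorial_succ, Nat.factorial_succ]
  push_cast
  rw [show (m : ℝ) + 1 + d + 1 + a + a + 1 + 1 = m + 1 + d + (a + 1) + (a + 1) + 1 by ring,
    show a + ((m : ℝ) + 1) + 1 = a + 1 + m + 1 by ring,
    show a + 1 + ((m : ℝ) + 1) + 1 = a + 1 + m + 1 + 1 by ring]
  have h1 : ((m.factorial : ℝ)) ≠ 0 := by positivity
  have h2 : ((d.factorial : ℝ)) ≠ 0 := by positivity
  have h3 : (m : ℝ) + 1 ≠ 0 := by positivity
  have h4 : (d : ℝ) + 1 ≠ 0 := by positivity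
  field_simp
  ring

lemma ultraCoeff_shift_zero (n : ℕ) (a : ℝ) :
    ((n : ℝ) + 1) * ultraCoeff (n + 1) a 0 = (a + 1) * ultraCoeff n (a + 1) 0 := by
  unfold ultraCoeff
  simp only [Nat.sub_zero, ascPochhammer_zero, Polynomial.eval_one, Nat.factorial_zero]
  rw [ascPochhammer_eval_succ_left, Nat.factorial_succ]
  push_cast
  rw [show a + 0 + 1 + 1 = a + 1 + 0 + 1 by ring]
  have h2 : ((n.factorial : ℝ)) ≠ 0 := by positivity
  have h4 : (n : ℝ) + 1 ≠ 0 := by positivity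
  field_simp
  ring

lemma ultraCoeff_shift_last (n : ℕ) (a : ℝ) :
    ((n : ℝ) + 1) * ultraCoeff (n + 1) a (n + 1) =
      ((n : ℝ) + 2 * a + 2) * ultraCoeff n (a + 1) n := by
  have := ultraCoeff_succ_succ n a n
  exact this

/-- The raising identity behind Rodrigues' formula. -/
lemma jacobiP_raise (n : ℕ) (a x P' : ℝ)
    (hP' : HasDerivAt (jacobiP n (a + 1) (a + 1)) P' x) :
    (1 - x ^ 2) * P' - 2 * (a + 1) * x * jacobiP n (a + 1) (a + 1) x =
      -2 * ((n : ℝ) + 1) * jacobiP (n + 1) a a x := by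
  rw [hP'.unique (hasDerivAt_jacobiP_sum n (a + 1) x)]
  set y := (x - 1) / 2 with hy
  have hx : x = 1 + 2 * y := by rw [hy]; ring
  set c := ultraCoeff n (a + 1)
  have key : ((n : ℝ) + 1) * jacobiP (n + 1) a a x =
      ∑ m ∈ Finset.range (n + 1), ((m : ℝ) + a + 1) * c m * y ^ m +
      ∑ m ∈ Finset.range (n + 1), ((m : ℝ) + 2 * a + 2) * c m * y ^ (m + 1) := by
    rw [jacobiP_eq_sum, Finset.mul_sum, ← hy, Finset.sum_range_succ', Finset.sum_range_succ]
    rw [Finset.sum_range_succ' (fun m : ℕ => ((m : ℝ) + a + 1) * c m * y ^ m),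
      Finset.sum_range_succ (fun m : ℕ => ((m : ℝ) + 2 * a + 2) * c m * y ^ (m + 1))]
    have h1 : ∀ m ∈ Finset.range n,
        ((n : ℝ) + 1) * (ultraCoeff (n + 1) a (m + 1) * y ^ (m + 1)) =
        (((m + 1 : ℕ) : ℝ) + a + 1) * c (m + 1) * y ^ (m + 1) +
        ((m : ℝ) + 2 * a + 2) * c m * y ^ (m + 1) := by
      intro m hm
      have := ultraCoeff_shift n a m (Finset.mem_range.1 hm)
      push_cast
      linear_combination y ^ (m + 1) * this
    rw [Finset.sum_congr rfl h1, Finset.sum_add_distrib]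
    have h2 := ultraCoeff_shift_zero n a
    have h3 := ultraCoeff_shift_last n a
    push_cast
    linear_combination h2 + y ^ (n + 1) * h3
  have hyP : y * ∑ m ∈ Finset.range (n + 1), c m * (m * y ^ (m - 1) * (1 / 2)) =
      ∑ m ∈ Finset.range (n + 1), c m * (m * y ^ m * (1 / 2)) := by
    rw [Finset.mul_sum]
    refine Finset.sum_congr rfl fun m _ => ?_
    rcases m with _ | m
    · simp
    · rw [Nat.add_sub_cancel]; ring
  have e : -2 * ((n : ℝ) + 1) * jacobiP (n + 1) a a x =
      -2 * (((n : ℝ) + 1) * jacobiP (n + 1) a a x) := by ring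
  rw [e, key, jacobiP_eq_sum, ← hy]
  -- The factor `y` of `1 - x²` restores the exponent lowered by differentiation, so the truncated
  -- `m - 1` at `m = 0` is harmless.
  have e2 : (1 - x ^ 2) = -4 * (1 + y) * y := by rw [hx]; ring
  rw [e2, mul_assoc _ y, hyP, hx]
  simp only [Finset.mul_sum, ← Finset.sum_add_distrib, ← Finset.sum_sub_distrib]
  refine Finset.sum_congr rfl fun m _ => ?_
  ring

/-- The raising operator sends `P_n^{a+1,a+1}` to a multiple of `P_{n+1}^{a,a}` and reverses parity.
The induction changes the parameter, hence the quantifier over `a`. -/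
lemma jacobiP_neg (n : ℕ) : ∀ a x : ℝ, jacobiP n a a (-x) = (-1) ^ n * jacobiP n a a x := by
  induction n with
  | zero => intro a x; simp [jacobiP_zero]
  | succ n ih =>
    intro a x
    have hd := (hasDerivAt_jacobiP_sum n (a + 1) (-x))
    obtain ⟨P', hP'⟩ : ∃ P', HasDerivAt (jacobiP n (a + 1) (a + 1)) P' (-x) := ⟨_, hd⟩
    have h1 : HasDerivAt (jacobiP n (a + 1) (a + 1)) ((-1) ^ n * (P' * -1)) x := by
      have h2 := (hP'.comp x (hasDerivAt_neg x)).const_mul ((-1 : ℝ) ^ n)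
      refine h2.congr_of_eventuallyEq (Eventually.of_forall fun z => ?_)
      simp only [Function.comp, ih]
      rw [← mul_assoc, ← mul_pow]
      simp
    have e1 := jacobiP_raise n a x _ h1
    have e2 := jacobiP_raise n a (-x) _ hP'
    rw [ih] at e2
    have hn : (n : ℝ) + 1 ≠ 0 := by positivity
    have h4 : ((-1 : ℝ) ^ n) * (-1) ^ n = 1 := by rw [← mul_pow]; simp
    have : -2 * ((n : ℝ) + 1) * (jacobiP (n + 1) a a (-x) - (-1) ^ (n + 1) * jacobiP (n + 1) a a x)
        = 0 := by
      rw [pow_succ]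
      linear_combination (-1 : ℝ) * e2 + (-1) ^ n * (-1) * e1 + (-(1 - x^2) * P') * h4
    rcases mul_eq_zero.1 this with h | h
    · exfalso; apply hn; linarith
    · linarith

/-- At `x = 0` the raising identity keeps only its derivative term, and the derivative is again
ultraspherical; together they pass from degree `2N` and parameter `a + 2` to degree `2N + 2` and
parameter `a`. -/
lemma jacobiP_zero_arg (N : ℕ) : ∀ a : ℝ, jacobiP (2 * N) a a 0 =
    (-1) ^ N * (ascPochhammer ℝ N).eval ((N : ℝ) + a + 1) / (4 ^ N * N.factorial) := by
  induction N with
  | zero => intro a; simp [jacobiP_zero]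
  | succ N ih =>
    intro a
    have h1 := jacobiP_raise (2 * N + 1) a 0 _ (hasDerivAt_jacobiP_succ (2 * N) (a + 1) 0)
    rw [show 2 * (N + 1) = 2 * N + 1 + 1 by ring, Nat.factorial_succ]
    rw [ih] at h1
    rw [ascPochhammer_eval_succ_left, pow_succ, pow_succ]
    push_cast at h1 ⊢
    rw [show (N : ℝ) + 1 + a + 1 + 1 = N + (a + 1 + 1) + 1 by ring]
    have h2 : ((N.factorial : ℝ)) ≠ 0 := by positivity
    have h4 : (N : ℝ) + 1 ≠ 0 := by positivity
    set P := jacobiP (2 * N + 1 + 1) a a 0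
    have h3 : P = -((2 * N + 2 * (a + 1) + 2) / 2 *
        ((-1) ^ N * Polynomial.eval (N + (a + 1 + 1) + 1) (ascPochhammer ℝ N) / (4 ^ N * N.factorial)))
          / (4 * (N + 1)) := by
      rw [eq_div_iff (by positivity)]
      linear_combination h1
    rw [h3]
    field_simp
    ring

/-- The Gegenbauer differential equation. -/
lemma jacobiP_ode (n : ℕ) (a x P1 P2 : ℝ) (f : ℝ → ℝ)
    (h1 : ∀ z, HasDerivAt (jacobiP n a a) (f z) z) (hP1 : P1 = f x) (h2 : HasDerivAt f P2 x) :
    (1 - x ^ 2) * P2 = 2 * (a + 1) * x * P1 - n * (n + 2 * a + 1) * jacobiP n a a x := by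
  rcases n with _ | n
  · have hf : f = fun _ => 0 := by
      funext z
      refine (h1 z).unique ?_
      refine (hasDerivAt_const z (1 : ℝ)).congr_of_eventuallyEq (Eventually.of_forall fun z => ?_)
      exact jacobiP_zero a a z
    subst hf
    rw [h2.unique (hasDerivAt_const x (0 : ℝ)), hP1]
    simp
  · have hf : f = fun z => ((n : ℝ) + 2 * a + 2) / 2 * jacobiP n (a + 1) (a + 1) z := by
      funext z
      exact (h1 z).unique (hasDerivAt_jacobiP_succ n a z)
    subst hf
    obtain ⟨Q, hQ⟩ : ∃ Q, HasDerivAt (jacobiP n (a + 1) (a + 1)) Q x :=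
      ⟨_, hasDerivAt_jacobiP_sum n (a + 1) x⟩
    have := jacobiP_raise n a x Q hQ
    rw [h2.unique (hQ.const_mul _), hP1]
    push_cast
    linear_combination ((n : ℝ) + 2 * a + 2) / 2 * this

lemma iteratedDeriv_jacobiP (j n : ℕ) : ∀ a : ℝ, iteratedDeriv j (jacobiP (n + j) a a) =
    fun x => (ascPochhammer ℝ j).eval ((n : ℝ) + j + 2 * a + 1) / 2 ^ j *
      jacobiP n (a + j) (a + j) x := by
  induction j with
  | zero => intro a; funext x; simp
  | succ j ih =>
    intro a
    have h : deriv (jacobiP (n + j + 1) a a) = fun x =>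
        (((n + j : ℕ) : ℝ) + 2 * a + 2) / 2 * jacobiP (n + j) (a + 1) (a + 1) x :=
      funext fun x => (hasDerivAt_jacobiP_succ (n + j) a x).deriv
    rw [iteratedDeriv_succ', ← add_assoc, h]
    funext x
    rw [iteratedDeriv_const_mul_field, ih, ascPochhammer_eval_succ_left, pow_succ]
    push_cast
    rw [show (n : ℝ) + j + 2 * (a + 1) + 1 = n + (j + 1) + 2 * a + 1 + 1 by ring,
      show a + 1 + (j : ℝ) = a + (j + 1) by ring]
    field_simp
    ring

/-! ### Uniqueness for the differential equation -/

/-- Uniqueness for `(1 - x²) y'' = p x y' + q y` on `(-1, 1)`. -/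
lemma eq_zero_of_ode (p q : ℝ) (y y1 y2 : ℝ → ℝ)
    (h1 : ∀ x ∈ Ioo (-1 : ℝ) 1, HasDerivAt y (y1 x) x)
    (h2 : ∀ x ∈ Ioo (-1 : ℝ) 1, HasDerivAt y1 (y2 x) x)
    (h3 : ∀ x ∈ Ioo (-1 : ℝ) 1, (1 - x ^ 2) * y2 x = p * x * y1 x + q * y x)
    (h0 : y 0 = 0) (h0' : y1 0 = 0) : ∀ x ∈ Ioo (-1 : ℝ) 1, y x = 0 := by
  intro x hx
  obtain ⟨b, hxb, hb1⟩ := exists_between (abs_lt.2 ⟨hx.1, hx.2⟩)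
  have hb0 : 0 < b := (abs_nonneg x).trans_lt hxb
  -- A Lipschitz constant for the equivalent first-order system on `(-b, b)`, where `1 - t² ≥ 1 - b²
  -- > 0`: the quotient serves the second component, the added `1` the first.
  set M : ℝ := (|p| + |q|) / (1 - b ^ 2) + 1 with hM
  have hb2 : 0 < 1 - b ^ 2 := by nlinarith
  have hMnn : 0 ≤ M := by positivity
  let v : ℝ → ℝ × ℝ → ℝ × ℝ := fun t z => (z.2, (p * t * z.2 + q * z.1) / (1 - t ^ 2))
  have hlip : ∀ t ∈ Ioo (-b) b, LipschitzOnWith (⟨M, hMnn⟩ : NNReal) (v t) univ := by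
    intro t ht
    have ht2 : 1 - b ^ 2 ≤ 1 - t ^ 2 := by nlinarith [ht.1, ht.2]
    have ht1 : |t| ≤ 1 := by
      rw [abs_le]; constructor <;> linarith [ht.1, ht.2]
    refine LipschitzOnWith.of_dist_le_mul fun z _ w _ => ?_
    have hz1 : |z.1 - w.1| ≤ dist z w := by
      rw [Prod.dist_eq, ← Real.dist_eq]; exact le_max_left _ _
    have hz2 : |z.2 - w.2| ≤ dist z w := by
      rw [Prod.dist_eq, ← Real.dist_eq]; exact le_max_right _ _
    have hd := dist_nonneg (x := z) (y := w)
    change dist (v t z) (v t w) ≤ M * dist z w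
    rw [Prod.dist_eq]
    refine max_le ?_ ?_
    · change dist z.2 w.2 ≤ _
      rw [Real.dist_eq]
      have : 1 ≤ M := by
        rw [hM]; have : 0 ≤ (|p| + |q|) / (1 - b ^ 2) := by positivity
        linarith
      nlinarith
    · change dist ((p * t * z.2 + q * z.1) / (1 - t ^ 2)) ((p * t * w.2 + q * w.1) / (1 - t ^ 2)) ≤ _
      rw [Real.dist_eq, ← sub_div, abs_div, abs_of_pos (hb2.trans_le ht2)]
      have e : p * t * z.2 + q * z.1 - (p * t * w.2 + q * w.1) =
        p * t * (z.2 - w.2) + q * (z.1 - w.1) := by ring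
      have h5 : |p * t * z.2 + q * z.1 - (p * t * w.2 + q * w.1)| ≤ (|p| + |q|) * dist z w := by
        rw [e]
        refine (abs_add_le _ _).trans ?_
        rw [abs_mul, abs_mul, abs_mul, add_mul]
        have : |p| * |t| ≤ |p| := mul_le_of_le_one_right (abs_nonneg _) ht1
        gcongr
      calc _ ≤ (|p| + |q|) * dist z w / (1 - b ^ 2) := by gcongr
        _ = (|p| + |q|) / (1 - b ^ 2) * dist z w := by ring
        _ ≤ M * dist z w := by rw [hM]; gcongr; linarith
  have hsub : ∀ t ∈ Ioo (-b) b, t ∈ Ioo (-1 : ℝ) 1 := fun t ht =>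
    ⟨by linarith [ht.1], by linarith [ht.2]⟩
  have hf : ∀ t ∈ Ioo (-b) b, HasDerivAt (fun t => (y t, y1 t)) (v t (y t, y1 t)) t ∧
      (y t, y1 t) ∈ (univ : Set (ℝ × ℝ)) := by
    intro t ht
    refine ⟨?_, mem_univ _⟩
    have ht' := hsub t ht
    have h4 : 0 < 1 - t ^ 2 := by nlinarith [ht'.1, ht'.2]
    have : v t (y t, y1 t) = (y1 t, y2 t) := by
      simp only [v]
      rw [← h3 t ht', mul_div_cancel_left₀ _ h4.ne']
    rw [this]
    exact (h1 t ht').prodMk (h2 t ht')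
  have hg : ∀ t ∈ Ioo (-b) b, HasDerivAt (fun _ : ℝ => ((0 : ℝ), (0 : ℝ))) (v t (0, 0)) t ∧
      ((0 : ℝ), (0 : ℝ)) ∈ (univ : Set (ℝ × ℝ)) := by
    intro t ht
    refine ⟨?_, mem_univ _⟩
    have : v t (0, 0) = 0 := by simp [v]
    rw [this]
    exact hasDerivAt_const t _
  have := ODE_solution_unique_of_mem_Ioo (t₀ := 0) hlip ⟨by linarith, hb0⟩ hf hg (by simp [h0, h0'])
    (abs_lt.1 hxb)
  exact congrArg Prod.fst this

/-! ### Exponential generating functions and the hypergeometric series -/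

/-- The exponential generating function of a sequence. -/
def egf (A : ℕ → ℝ) (x : ℝ) : ℝ := ∑' k, A k * x ^ k / k.factorial

/-- Growth of a sequence by at most `k! k^q`, which makes its exponential generating function
converge on `(-1, 1)`. -/
def FactorialGrowth (A : ℕ → ℝ) : Prop := ∃ C : ℝ, ∃ q : ℕ, ∀ k, |A k| ≤ C * (q + k).factorial

lemma FactorialGrowth.shift {A : ℕ → ℝ} (h : FactorialGrowth A) (n : ℕ) :
    FactorialGrowth (fun k => A (k + n)) := by
  obtain ⟨C, q, h⟩ := h
  refine ⟨C, q + n, fun k => ?_⟩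
  rw [show q + n + k = q + (k + n) by ring]
  exact h _

lemma FactorialGrowth.nonneg {C : ℝ} {q : ℕ} {A : ℕ → ℝ} (h : ∀ k, |A k| ≤ C * (q + k).factorial) :
    0 ≤ C := by
  by_contra hC
  have h0 := (abs_nonneg _).trans (h 0)
  have : (0 : ℝ) < (q + 0).factorial := by positivity
  nlinarith

lemma FactorialGrowth.const_mul {A : ℕ → ℝ} (h : FactorialGrowth A) (c : ℝ) :
    FactorialGrowth (fun k => c * A k) := by
  obtain ⟨C, q, h⟩ := h
  refine ⟨|c| * C, q, fun k => ?_⟩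
  rw [abs_mul, mul_assoc]
  gcongr
  exact h k

lemma FactorialGrowth.natCast_mul {A : ℕ → ℝ} (h : FactorialGrowth A) :
    FactorialGrowth (fun k => k * A k) := by
  obtain ⟨C, q, h⟩ := h
  refine ⟨C, q + 1, fun k => ?_⟩
  have hC := FactorialGrowth.nonneg h
  rw [abs_mul, Nat.abs_cast, show q + 1 + k = q + k + 1 by ring, Nat.factorial_succ]
  push_cast
  calc (k : ℝ) * |A k| ≤ (q + k + 1) * (C * (q + k).factorial) := by
        gcongr
        · linarith [Nat.cast_nonneg (α := ℝ) q]
        · exact h k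
    _ = _ := by ring

/-- The coefficients are `q!` times binomial coefficients, so this is a negative binomial series. -/
lemma summable_factorial_ratio (q : ℕ) {r : ℝ} (hr0 : 0 ≤ r) (hr : r < 1) :
    Summable fun k : ℕ => ((q + k).factorial : ℝ) * r ^ k / k.factorial := by
  have h := (summable_choose_mul_geometric_of_norm_lt_one q
    (r := r) (by rwa [Real.norm_of_nonneg hr0])).mul_left (q.factorial : ℝ)
  refine h.congr fun k => ?_
  have h1 : ((k + q).choose q : ℝ) * q.factorial * k.factorial = (k + q).factorial := by
    have := Nat.choose_mul_factorial_mul_factorial (Nat.le_add_left q k)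
    rw [Nat.add_sub_cancel] at this
    exact_mod_cast this
  rw [add_comm q k, ← h1]
  field_simp

lemma FactorialGrowth.summable {A : ℕ → ℝ} (h : FactorialGrowth A) {x : ℝ} (hx : |x| < 1) :
    Summable fun k => A k * x ^ k / k.factorial := by
  obtain ⟨C, q, h⟩ := h
  refine Summable.of_norm_bounded ((summable_factorial_ratio q (abs_nonneg x) hx).mul_left C)
    fun k => ?_
  rw [Real.norm_eq_abs, abs_div, abs_mul, abs_pow, Nat.abs_cast, ← mul_div_assoc, ← mul_assoc]
  gcongr
  exact h k

lemma egf_zero (A : ℕ → ℝ) : egf A 0 = A 0 := by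
  unfold egf
  rw [tsum_eq_single 0]
  · simp
  · intro k hk; simp [hk]

lemma succ_mul_div_factorial (a y : ℝ) (k : ℕ) :
    a * (((k : ℝ) + 1) * y) / ((k + 1).factorial : ℝ) = a * y / k.factorial := by
  rw [Nat.factorial_succ]
  push_cast
  have : (k : ℝ) + 1 ≠ 0 := by positivity
  field_simp

/-- Termwise differentiation, dominated on `|y| < r` for some `r` between `|x|` and `1`. -/
lemma hasDerivAt_egf {A : ℕ → ℝ} (h : FactorialGrowth A) {x : ℝ} (hx : x ∈ Ioo (-1 : ℝ) 1) :
    HasDerivAt (egf A) (egf (fun k => A (k + 1)) x) x := by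
  obtain ⟨r, hxr, hr1⟩ := exists_between (abs_lt.2 ⟨hx.1, hx.2⟩)
  have hr0 : 0 < r := (abs_nonneg x).trans_lt hxr
  obtain ⟨C, q, hC⟩ := id h
  have hC0 := FactorialGrowth.nonneg hC
  have hu : Summable fun k : ℕ => C * (q + k).factorial * (k * r ^ (k - 1)) / k.factorial := by
    rw [← summable_nat_add_iff 1]
    refine ((summable_factorial_ratio (q + 1) hr0.le hr1).mul_left C).congr fun k => ?_
    push_cast
    rw [succ_mul_div_factorial, show q + 1 + k = q + (k + 1) by ring]
    ring
  have hd := hasDerivAt_tsum_of_isPreconnected (g := fun k y => A k * y ^ k / k.factorial)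
    (g' := fun k y => A k * (k * y ^ (k - 1)) / k.factorial) (t := Ioo (-r) r) hu isOpen_Ioo
    isPreconnected_Ioo
    (fun k y _ => ((hasDerivAt_pow k y).const_mul (A k)).div_const _)
    (fun k y hy => by
      have : |y| ≤ r := abs_le.2 ⟨hy.1.le, hy.2.le⟩
      rw [Real.norm_eq_abs, abs_div, abs_mul, abs_mul, abs_pow, Nat.abs_cast, Nat.abs_cast]
      gcongr
      exact hC k)
    (y₀ := 0) ⟨by linarith, hr0⟩ (h.summable (by simp)) (abs_lt.1 hxr)
  refine hd.congr_deriv ?_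
  have hs : Summable fun k : ℕ => A k * (k * x ^ (k - 1)) / k.factorial := by
    rw [← summable_nat_add_iff 1]
    refine ((h.shift 1).summable (abs_lt.2 hx)).congr fun k => ?_
    push_cast
    rw [succ_mul_div_factorial]
  rw [hs.tsum_eq_zero_add]
  simp only [Nat.cast_zero, zero_mul, mul_zero, zero_div, zero_add, egf]
  refine tsum_congr fun k => ?_
  push_cast
  rw [succ_mul_div_factorial]

lemma iteratedDeriv_egf {A : ℕ → ℝ} (h : FactorialGrowth A) (n : ℕ) :
    EqOn (iteratedDeriv n (egf A)) (egf (fun k => A (k + n))) (Ioo (-1) 1) := by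
  induction n with
  | zero => intro x _; simp
  | succ n ih =>
    intro x hx
    rw [iteratedDeriv_succ, (ih.eventuallyEq_of_mem (isOpen_Ioo.mem_nhds hx)).deriv_eq,
      (hasDerivAt_egf (h.shift n) hx).deriv]
    simp only [add_assoc, add_comm 1 n]

lemma mul_egf_shift {A : ℕ → ℝ} (h : FactorialGrowth A) {x : ℝ} (hx : x ∈ Ioo (-1 : ℝ) 1) :
    x * egf (fun k => A (k + 1)) x = egf (fun k => k * A k) x := by
  unfold egf
  rw [(h.natCast_mul.summable (abs_lt.2 hx)).tsum_eq_zero_add, ← tsum_mul_left]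
  simp only [Nat.cast_zero, zero_mul, zero_div, zero_add]
  refine tsum_congr fun k => ?_
  push_cast
  rw [show ((k : ℝ) + 1) * A (k + 1) * x ^ (k + 1) = (A (k + 1) * x) * ((k + 1) * x ^ k) by ring,
    succ_mul_div_factorial]
  ring

lemma egf_const_mul (A : ℕ → ℝ) (c x : ℝ) : egf (fun k => c * A k) x = c * egf A x := by
  unfold egf
  rw [← tsum_mul_left]
  exact tsum_congr fun k => by ring

/-- The sequence with `A₀ = 1`, `A₁ = 0` and `A_{k+2} = (k + a) (k + b) A_k`. Its exponential
generating function is the hypergeometric function `₂F₁(a/2, b/2; 1/2; x²)`. -/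
def hyperSeq (a b : ℝ) : ℕ → ℝ
  | 0 => 1
  | 1 => 0
  | k + 2 => ((k : ℝ) + a) * (k + b) * hyperSeq a b k

/-- The bound depends on the parameters only through `Q`; this uniformity later dominates the series
while the order varies. -/
lemma abs_hyperSeq_le (a b : ℝ) (Q : ℕ) (ha : |a| ≤ Q) (hb : |b| ≤ Q) (k : ℕ) :
    |hyperSeq a b k| ≤ (Q + k).factorial := by
  induction k using Nat.twoStepInduction with
  | zero =>
    simp only [hyperSeq, abs_one, add_zero]
    exact_mod_cast Nat.factorial_pos Q
  | one => simp [hyperSeq]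
  | more k ih _ =>
    have h1 : ∀ c : ℝ, |c| ≤ Q → |(k : ℝ) + c| ≤ Q + k := fun c hc => by
      refine (abs_add_le _ _).trans ?_
      rw [Nat.abs_cast]; linarith
    rw [hyperSeq, abs_mul, abs_mul, show Q + (k + 2) = Q + k + 1 + 1 by ring, Nat.factorial_succ,
      Nat.factorial_succ, ← mul_assoc]
    push_cast
    gcongr
    · exact (h1 a ha).trans (by linarith)
    · exact (h1 b hb).trans (by linarith)

lemma factorialGrowth_hyperSeq (a b : ℝ) : FactorialGrowth (hyperSeq a b) := by
  obtain ⟨Q, hQ⟩ := exists_nat_ge (max |a| |b|)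
  refine ⟨1, Q, fun k => ?_⟩
  rw [one_mul]
  exact abs_hyperSeq_le a b Q ((le_max_left _ _).trans hQ) ((le_max_right _ _).trans hQ) k

/-- Since `(k + a)(k + b) = k(k - 1) + (a + b + 1)k + ab`, and multiplication by `k(k - 1)` and by
`k` corresponds to `x² D²` and `x D`, the recursion is the equation. -/
lemma hyperSeq_ode (a b : ℝ) {x : ℝ} (hx : x ∈ Ioo (-1 : ℝ) 1) :
    (1 - x ^ 2) * egf (fun k => hyperSeq a b (k + 2)) x =
      (a + b + 1) * x * egf (fun k => hyperSeq a b (k + 1)) x + a * b * egf (hyperSeq a b) x := by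
  set A := hyperSeq a b
  have hA : FactorialGrowth A := factorialGrowth_hyperSeq a b
  have e1 : x * egf (fun k => A (k + 1)) x = egf (fun k => k * A k) x := mul_egf_shift hA hx
  have e2 : x * egf (fun k => A (k + 2)) x = egf (fun k => k * A (k + 1)) x :=
    mul_egf_shift (hA.shift 1) hx
  have e3 : x * egf (fun k => k * A (k + 1)) x = egf (fun k => k * (k - 1) * A k) x := by
    have hB : FactorialGrowth (fun k : ℕ => ((k : ℝ) - 1) * A k) := by
      obtain ⟨C, q, h⟩ := id hA
      obtain ⟨C', q', h'⟩ := hA.natCast_mul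
      refine ⟨C + C', q + q', fun k => ?_⟩
      have hC := FactorialGrowth.nonneg h
      have hC' := FactorialGrowth.nonneg h'
      have : ((k : ℝ) - 1) * A k = k * A k - A k := by ring
      change |((k : ℝ) - 1) * A k| ≤ _
      rw [this]
      refine (abs_sub _ _).trans ?_
      have i1 : ((q + k).factorial : ℝ) ≤ (q + q' + k).factorial := by
        exact_mod_cast Nat.factorial_le (by omega)
      have i2 : ((q' + k).factorial : ℝ) ≤ (q + q' + k).factorial := by
        exact_mod_cast Nat.factorial_le (by omega)
      nlinarith [h k, h' k, mul_le_mul_of_nonneg_left i1 hC, mul_le_mul_of_nonneg_left i2 hC']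
    have := mul_egf_shift hB hx
    push_cast at this
    simp only [add_sub_cancel_right, ← mul_assoc] at this
    exact this
  have e4 : egf (fun k => A (k + 2)) x = egf (fun k => k * (k - 1) * A k) x +
      (a + b + 1) * egf (fun k => k * A k) x + a * b * egf A x := by
    rw [← egf_const_mul, ← egf_const_mul]
    have s1 : Summable fun k : ℕ => ((k : ℝ) * (k - 1) * A k) * x ^ k / k.factorial := by
      have : Summable fun k : ℕ => ((k : ℝ) * (k * A k) - k * A k) * x ^ k / k.factorial := by
        refine ((hA.natCast_mul.natCast_mul.summable (abs_lt.2 hx)).sub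
          (hA.natCast_mul.summable (abs_lt.2 hx))).congr fun k => ?_
        ring
      refine this.congr fun k => ?_
      ring
    have s2 := (hA.natCast_mul.const_mul (a + b + 1)).summable (abs_lt.2 hx)
    have s3 := (hA.const_mul (a * b)).summable (abs_lt.2 hx)
    unfold egf
    rw [← s1.tsum_add s2, ← (s1.add s2).tsum_add s3]
    refine tsum_congr fun k => ?_
    change (((k : ℝ) + a) * (k + b) * A k) * x ^ k / k.factorial = _
    ring
  linear_combination e4 - x * e2 - e3 - (a + b + 1) * e1

/-- An even solution of the hypergeometric equation on `(-1, 1)` is a multiple of the series. -/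
lemma eq_egf_hyperSeq (a b : ℝ) (y y1 y2 : ℝ → ℝ)
    (h1 : ∀ x ∈ Ioo (-1 : ℝ) 1, HasDerivAt y (y1 x) x)
    (h2 : ∀ x ∈ Ioo (-1 : ℝ) 1, HasDerivAt y1 (y2 x) x)
    (h3 : ∀ x ∈ Ioo (-1 : ℝ) 1, (1 - x ^ 2) * y2 x = (a + b + 1) * x * y1 x + a * b * y x)
    (h0 : y1 0 = 0) : ∀ x ∈ Ioo (-1 : ℝ) 1, y x = y 0 * egf (hyperSeq a b) x := by
  intro x hx
  have hA := factorialGrowth_hyperSeq a b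
  have := eq_zero_of_ode (a + b + 1) (a * b) (fun x => y x - y 0 * egf (hyperSeq a b) x)
    (fun x => y1 x - y 0 * egf (fun k => hyperSeq a b (k + 1)) x)
    (fun x => y2 x - y 0 * egf (fun k => hyperSeq a b (k + 2)) x)
    (fun x hx => (h1 x hx).sub ((hasDerivAt_egf hA hx).const_mul _))
    (fun x hx => (h2 x hx).sub ((hasDerivAt_egf (hA.shift 1) hx).const_mul _))
    (fun x hx => by linear_combination h3 x hx - y 0 * hyperSeq_ode a b hx)
    (by simp [egf_zero, hyperSeq]) (by simp [egf_zero, hyperSeq, h0]) x hx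
  linarith

/-- Even shifts only move the parameters, so an even number of derivatives of the series gives a
multiple of a series of the same family. -/
lemma hyperSeq_add (a b : ℝ) (h k : ℕ) : hyperSeq a b (k + 2 * h) =
    hyperSeq a b (2 * h) * hyperSeq (a + 2 * h) (b + 2 * h) k := by
  induction k using Nat.twoStepInduction with
  | zero => simp [hyperSeq]
  | one =>
    have : hyperSeq a b (1 + 2 * h) = 0 := by
      induction h with
      | zero => simp [hyperSeq]
      | succ h ih => rw [show 1 + 2 * (h + 1) = 1 + 2 * h + 2 by ring, hyperSeq, ih, mul_zero]
    simp [hyperSeq, this]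
  | more k ih _ =>
    rw [show k + 2 + 2 * h = k + 2 * h + 2 by ring, hyperSeq, ih, hyperSeq]
    push_cast
    ring

lemma continuous_hyperSeq {a b : ℝ → ℝ} (ha : Continuous a) (hb : Continuous b) (k : ℕ) :
    Continuous fun r => hyperSeq (a r) (b r) k := by
  induction k using Nat.twoStepInduction with
  | zero => simpa [hyperSeq] using continuous_const
  | one => simpa [hyperSeq] using continuous_const
  | more k ih _ =>
    simp only [hyperSeq]
    fun_prop

lemma continuousAt_egf_hyperSeq {a b : ℝ → ℝ} (ha : Continuous a) (hb : Continuous b) (n : ℕ)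
    {x : ℝ} (hx : x ∈ Ioo (-1 : ℝ) 1) (s : ℝ) :
    ContinuousAt (fun r => egf (fun k => hyperSeq (a r) (b r) (k + n)) x) s := by
  obtain ⟨Q, hQ⟩ := exists_nat_ge (max |a s| |b s| + 1)
  have h1 : ∀ᶠ r in 𝓝 s, |a r| ≤ Q := by
    refine (ha.abs.continuousAt.eventually_lt continuousAt_const ?_).mono fun r hr => le_of_lt hr
    linarith [le_max_left |a s| |b s|]
  have h2 : ∀ᶠ r in 𝓝 s, |b r| ≤ Q := by
    refine (hb.abs.continuousAt.eventually_lt continuousAt_const ?_).mono fun r hr => le_of_lt hr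
    linarith [le_max_right |a s| |b s|]
  refine tendsto_tsum_of_dominated_convergence
    (summable_factorial_ratio (Q + n) (abs_nonneg x) (abs_lt.2 hx)) (fun k => ?_) ?_
  · have := continuous_hyperSeq ha hb (k + n)
    exact ((this.mul_const _).div_const _).tendsto s
  · filter_upwards [h1, h2] with r hr1 hr2 k
    rw [Real.norm_eq_abs, abs_div, abs_mul, abs_pow, Nat.abs_cast,
      show Q + n + k = Q + (k + n) by ring]
    gcongr
    exact abs_hyperSeq_le _ _ Q hr1 hr2 _

/-! ### Fractional integrals of functions with a power singularity at `-1` -/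

open scoped ContDiff

/-- The left Riemann–Liouville integral without its Gamma factor. -/
def rlInt (ρ : ℝ) (v : ℝ → ℝ) (x : ℝ) : ℝ := ∫ t in (-1 : ℝ)..x, v t * (x - t) ^ (ρ - 1)

/-- `v = (1 + t)^β φ(t)` on `(-1, 1)` with `φ` smooth on `(-∞, 1)`. -/
def EndSmooth (β : ℝ) (v : ℝ → ℝ) : Prop :=
  ∃ φ : ℝ → ℝ, ContDiffOn ℝ ∞ φ (Iio 1) ∧ ∀ t ∈ Ioo (-1 : ℝ) 1, v t = (1 + t) ^ β * φ t

/-- The open interval keeps the conventional values of powers of `0` at the endpoints out of every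
comparison. -/
lemma intervalIntegral_congr_Ioo {a b : ℝ} (hab : a ≤ b) {f g : ℝ → ℝ}
    (h : ∀ t ∈ Ioo a b, f t = g t) : ∫ t in a..b, f t = ∫ t in a..b, g t := by
  rw [intervalIntegral.integral_of_le hab, intervalIntegral.integral_of_le hab,
    integral_Ioc_eq_integral_Ioo, integral_Ioc_eq_integral_Ioo]
  exact setIntegral_congr_fun measurableSet_Ioo h

lemma intervalIntegrable_congr_Ioo {a b : ℝ} (hab : a ≤ b) {f g : ℝ → ℝ}
    (h : ∀ t ∈ Ioo a b, f t = g t) (hf : IntervalIntegrable f volume a b) :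
    IntervalIntegrable g volume a b := by
  rw [intervalIntegrable_iff_integrableOn_Ioo_of_le hab] at hf ⊢
  exact hf.congr_fun h measurableSet_Ioo

/-- Integrability of a Beta weight times a continuous function. -/
lemma intervalIntegrable_betaWeight {a b β γ : ℝ} (hab : a < b) (hβ : -1 < β) (hγ : -1 < γ)
    {φ : ℝ → ℝ} (hφ : ContinuousOn φ (Icc a b)) :
    IntervalIntegrable (fun t => (t - a) ^ β * (b - t) ^ γ * φ t) volume a b := by
  have key : IntervalIntegrable (fun t => (t - a) ^ β * (b - t) ^ γ) volume a b := by
    have i1 : ∀ c, IntervalIntegrable (fun t => (t - a) ^ β) volume a c := fun c => by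
      have := (intervalIntegral.intervalIntegrable_rpow' hβ (a := 0) (b := c - a)).comp_sub_right a
      simpa using this
    have i2 : ∀ c, IntervalIntegrable (fun t => (b - t) ^ γ) volume c b := fun c => by
      have := (intervalIntegral.intervalIntegrable_rpow' hγ (a := b - c) (b := 0)).comp_sub_left b
      simpa using this
    have hm1 : a < (a + b) / 2 := by linarith
    have hm2 : (a + b) / 2 < b := by linarith
    refine IntervalIntegrable.trans (b := (a + b) / 2) ?_ ?_
    · refine (i1 _).mul_continuousOn ?_
      rw [uIcc_of_le hm1.le]
      refine ContinuousOn.rpow_const (by fun_prop) fun t ht => Or.inl ?_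
      have := ht.2
      exact (by linarith : (0 : ℝ) < b - t).ne'
    · refine (i2 _).continuousOn_mul ?_
      rw [uIcc_of_le hm2.le]
      refine ContinuousOn.rpow_const (by fun_prop) fun t ht => Or.inl ?_
      have := ht.1
      exact (by linarith : (0 : ℝ) < t - a).ne'
  refine key.mul_continuousOn ?_
  rwa [uIcc_of_le hab.le]

/-- The moving average `∫₀¹ g(τ) φ(-1 + (1 + x) τ) dτ`. -/
def dilationInt (g φ : ℝ → ℝ) (x : ℝ) : ℝ := ∫ τ in (0 : ℝ)..1, g τ * φ (-1 + (1 + x) * τ)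

lemma dilation_mem {b x τ : ℝ} (hx : -1 ≤ x) (hxb : x ≤ b) (hτ : τ ∈ Icc (0 : ℝ) 1) :
    -1 + (1 + x) * τ ∈ Icc (-1 : ℝ) b := by
  constructor <;> nlinarith [hτ.1, hτ.2]

lemma intervalIntegrable_dilation {g φ : ℝ → ℝ} (hg : IntervalIntegrable g volume 0 1)
    (hφ : ContinuousOn φ (Iio 1)) {x : ℝ} (hx : x ∈ Ioo (-1 : ℝ) 1) :
    IntervalIntegrable (fun τ => g τ * φ (-1 + (1 + x) * τ)) volume 0 1 := by
  refine hg.mul_continuousOn ?_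
  rw [uIcc_of_le zero_le_one]
  refine hφ.comp (by fun_prop) fun τ hτ => ?_
  exact (dilation_mem hx.1.le le_rfl hτ).2.trans_lt hx.2

/-- Here `x` occurs only in the argument of the smooth factor, not in the singular weight or the
limits, so differentiation under the integral is dominated by a multiple of `|g|`. -/
lemma hasDerivAt_dilationInt {g φ : ℝ → ℝ} (hg : IntervalIntegrable g volume 0 1)
    (hφ : ContDiffOn ℝ ∞ φ (Iio 1)) {x : ℝ} (hx : x ∈ Ioo (-1 : ℝ) 1) :
    HasDerivAt (dilationInt g φ) (dilationInt (fun τ => g τ * τ) (deriv φ) x) x := by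
  obtain ⟨b, hxb, hb1⟩ := exists_between hx.2
  obtain ⟨a, hxa, hax⟩ := exists_between hx.1
  have hφ' : ContinuousOn (deriv φ) (Iio 1) :=
    hφ.continuousOn_deriv_of_isOpen isOpen_Iio (by norm_num)
  obtain ⟨K, hK⟩ := isCompact_Icc.exists_bound_of_continuousOn
    (hφ'.mono (fun z (hz : z ∈ Icc (-1 : ℝ) b) => hz.2.trans_lt hb1))
  have hsub : ∀ y ∈ Ioo a b, y ∈ Ioo (-1 : ℝ) 1 := fun y hy =>
    ⟨hxa.trans hy.1, hy.2.trans hb1⟩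
  have hgτ : IntervalIntegrable (fun τ => g τ * τ) volume 0 1 :=
    hg.mul_continuousOn continuousOn_id
  have hnhds : Ioo a b ∈ 𝓝 x := isOpen_Ioo.mem_nhds ⟨hax, hxb⟩
  refine (intervalIntegral.hasDerivAt_integral_of_dominated_loc_of_deriv_le
    (F := fun y τ => g τ * φ (-1 + (1 + y) * τ))
    (F' := fun y τ => g τ * τ * deriv φ (-1 + (1 + y) * τ))
    (bound := fun τ => |g τ| * K) hnhds ?_ ?_ ?_ ?_ ?_ ?_).2
  · filter_upwards [hnhds] with y hy
    exact (intervalIntegrable_iff.1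
      (intervalIntegrable_dilation hg hφ.continuousOn (hsub y hy))).aestronglyMeasurable
  · exact intervalIntegrable_dilation hg hφ.continuousOn hx
  · exact (intervalIntegrable_iff.1
      (intervalIntegrable_dilation hgτ hφ' hx)).aestronglyMeasurable
  · refine Eventually.of_forall fun τ hτ y hy => ?_
    rw [uIoc_of_le zero_le_one] at hτ
    have h1 := hK _ (dilation_mem (hsub y hy).1.le hy.2.le ⟨hτ.1.le, hτ.2⟩)
    rw [norm_mul, norm_mul, Real.norm_eq_abs, Real.norm_of_nonneg hτ.1.le]
    have h2 : |g τ| * τ ≤ |g τ| := mul_le_of_le_one_right (abs_nonneg _) hτ.2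
    gcongr
  · exact hg.abs.mul_const K
  · refine Eventually.of_forall fun τ hτ y hy => ?_
    rw [uIoc_of_le zero_le_one] at hτ
    have h1 := (dilation_mem (hsub y hy).1.le hy.2.le ⟨hτ.1.le, hτ.2⟩).2.trans_lt hb1
    have h2 : HasDerivAt φ (deriv φ (-1 + (1 + y) * τ)) (-1 + (1 + y) * τ) :=
      ((hφ.contDiffAt (isOpen_Iio.mem_nhds h1)).differentiableAt (by norm_num)).hasDerivAt
    have h3 : HasDerivAt (fun y : ℝ => -1 + (1 + y) * τ) (1 * τ) y :=
      (((hasDerivAt_id y).const_add 1).mul_const τ).const_add _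
    refine ((h2.comp y h3).const_mul (g τ)).congr_deriv ?_
    ring

lemma contDiffOn_dilationInt (n : ℕ) : ∀ {g φ : ℝ → ℝ}, IntervalIntegrable g volume 0 1 →
    ContDiffOn ℝ ∞ φ (Iio 1) → ContDiffOn ℝ n (dilationInt g φ) (Ioo (-1) 1) := by
  induction n with
  | zero =>
    intro g φ hg hφ
    rw [Nat.cast_zero, contDiffOn_zero]
    exact fun x hx => (hasDerivAt_dilationInt hg hφ hx).continuousAt.continuousWithinAt
  | succ n ih =>
    intro g φ hg hφ
    rw [Nat.cast_succ, contDiffOn_succ_iff_deriv_of_isOpen isOpen_Ioo]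
    refine ⟨fun x hx => (hasDerivAt_dilationInt hg hφ hx).differentiableAt.differentiableWithinAt,
      by simp, ?_⟩
    refine (ih (hg.mul_continuousOn continuousOn_id)
      (hφ.deriv_of_isOpen isOpen_Iio (by simp) : ContDiffOn ℝ ∞ (deriv φ) (Iio 1))).congr
      fun x hx => ?_
    exact (hasDerivAt_dilationInt hg hφ hx).deriv

lemma intervalIntegrable_unitWeight {β ρ : ℝ} (hβ : -1 < β) (hρ : 0 < ρ) :
    IntervalIntegrable (fun τ : ℝ => τ ^ β * (1 - τ) ^ (ρ - 1)) volume 0 1 := by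
  have := intervalIntegrable_betaWeight (zero_lt_one' ℝ) hβ (by linarith : -1 < ρ - 1)
    (continuousOn_const (c := (1 : ℝ)))
  simpa using this

/-- Substitution `t = -1 + (1 + x) τ`, which freezes both endpoint singularities at `0` and `1`. -/
lemma rlInt_eq_dilationInt {β ρ : ℝ} {v φ : ℝ → ℝ}
    (hv : ∀ t ∈ Ioo (-1 : ℝ) 1, v t = (1 + t) ^ β * φ t) {x : ℝ} (hx : x ∈ Ioo (-1 : ℝ) 1) :
    rlInt ρ v x =
      (1 + x) ^ (β + ρ) * dilationInt (fun τ => τ ^ β * (1 - τ) ^ (ρ - 1)) φ x := by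
  have hc : 0 < 1 + x := by linarith [hx.1]
  have h := intervalIntegral.integral_comp_mul_add (a := 0) (b := 1)
    (fun t => v t * (x - t) ^ (ρ - 1)) hc.ne' (-1)
  have e1 : (1 + x) * 0 + -1 = -1 := by ring
  have e2 : (1 + x) * 1 + -1 = x := by ring
  rw [e1, e2, smul_eq_mul] at h
  have h' : rlInt ρ v x =
      (1 + x) * ∫ τ in (0 : ℝ)..1, v ((1 + x) * τ + -1) * (x - ((1 + x) * τ + -1)) ^ (ρ - 1) := by
    rw [h, ← mul_assoc, mul_inv_cancel₀ hc.ne', one_mul]; rfl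
  rw [h', dilationInt, ← intervalIntegral.integral_const_mul,
    ← intervalIntegral.integral_const_mul]
  refine intervalIntegral_congr_Ioo zero_le_one fun τ hτ => ?_
  have hm := dilation_mem hx.1.le le_rfl (Ioo_subset_Icc_self hτ)
  have hm1 : -1 + (1 + x) * τ ∈ Ioo (-1 : ℝ) 1 :=
    ⟨by nlinarith [hτ.1, mul_pos hc hτ.1], hm.2.trans_lt hx.2⟩
  rw [add_comm ((1 + x) * τ), hv _ hm1, show (1 : ℝ) + (-1 + (1 + x) * τ) = (1 + x) * τ by ring,
    show x - (-1 + (1 + x) * τ) = (1 + x) * (1 - τ) by ring,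
    Real.mul_rpow hc.le hτ.1.le, Real.mul_rpow hc.le (by linarith [hτ.2]),
    show β + ρ = 1 + β + (ρ - 1) by ring, Real.rpow_add hc, Real.rpow_add hc, Real.rpow_one]
  ring

lemma EndSmooth.intervalIntegrable {β ρ : ℝ} {v : ℝ → ℝ} (hv : EndSmooth β v) (hβ : -1 < β)
    (hρ : 0 < ρ) {x : ℝ} (hx : x ∈ Ioo (-1 : ℝ) 1) :
    IntervalIntegrable (fun t => v t * (x - t) ^ (ρ - 1)) volume (-1) x := by
  obtain ⟨φ, hφ, hv⟩ := hv
  refine intervalIntegrable_congr_Ioo hx.1.le (fun t ht => ?_)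
    (intervalIntegrable_betaWeight hx.1 hβ (by linarith : -1 < ρ - 1)
      (hφ.continuousOn.mono fun z (hz : z ∈ Icc (-1 : ℝ) x) => hz.2.trans_lt hx.2))
  rw [hv t ⟨ht.1, ht.2.trans hx.2⟩, show t - -1 = 1 + t by ring]
  ring

lemma EndSmooth.contDiffOn_rlInt {β ρ : ℝ} {v : ℝ → ℝ} (hv : EndSmooth β v) (hβ : -1 < β)
    (hρ : 0 < ρ) (n : ℕ) : ContDiffOn ℝ n (rlInt ρ v) (Ioo (-1) 1) := by
  obtain ⟨φ, hφ, hv⟩ := hv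
  refine ContDiffOn.congr ?_ fun x hx => rlInt_eq_dilationInt hv hx
  refine ContDiffOn.mul ?_ (contDiffOn_dilationInt n (intervalIntegrable_unitWeight hβ hρ) hφ)
  refine ContDiffOn.rpow_const_of_ne (by fun_prop) fun x hx => ?_
  have := hx.1
  exact (by linarith : 0 < 1 + x).ne'

lemma EndSmooth.smooth_mul {β : ℝ} {v q : ℝ → ℝ} (hv : EndSmooth β v) (hq : ContDiff ℝ ∞ q) :
    EndSmooth β (fun t => q t * v t) := by
  obtain ⟨φ, hφ, hv⟩ := hv
  refine ⟨fun t => q t * φ t, hq.contDiffOn.mul hφ, fun t ht => ?_⟩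
  change q t * v t = _ * (q t * φ t)
  rw [hv t ht]; ring

lemma EndSmooth.add {β : ℝ} {v w : ℝ → ℝ} (hv : EndSmooth β v) (hw : EndSmooth β w) :
    EndSmooth β (fun t => v t + w t) := by
  obtain ⟨φ, hφ, hv⟩ := hv
  obtain ⟨ψ, hψ, hw⟩ := hw
  refine ⟨fun t => φ t + ψ t, hφ.add hψ, fun t ht => ?_⟩
  change v t + w t = _ * (φ t + ψ t)
  rw [hv t ht, hw t ht]; ring

lemma hasDerivAt_endFactor {β : ℝ} {φ : ℝ → ℝ} (hφ : ContDiffOn ℝ ∞ φ (Iio 1)) {t : ℝ}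
    (ht : t ∈ Ioo (-1 : ℝ) 1) : HasDerivAt (fun t => (1 + t) ^ β * φ t)
      ((1 + t) ^ (β - 1) * (β * φ t + (1 + t) * deriv φ t)) t := by
  have hc : 0 < 1 + t := by linarith [ht.1]
  have h2 : HasDerivAt φ (deriv φ t) t :=
    ((hφ.contDiffAt (isOpen_Iio.mem_nhds ht.2)).differentiableAt (by norm_num)).hasDerivAt
  have h3 : HasDerivAt (fun t : ℝ => (1 + t) ^ β) (1 * β * (1 + t) ^ (β - 1)) t :=
    ((hasDerivAt_id t).const_add 1).rpow_const (Or.inl hc.ne')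
  refine (h3.mul h2).congr_deriv ?_
  have : (1 + t) ^ β = (1 + t) ^ (β - 1) * (1 + t) := by
    rw [← Real.rpow_add_one hc.ne']; ring_nf
  rw [this]; ring

lemma EndSmooth.hasDerivAt_eq {β : ℝ} {v v' φ : ℝ → ℝ}
    (hφ : ContDiffOn ℝ ∞ φ (Iio 1)) (hv : ∀ t ∈ Ioo (-1 : ℝ) 1, v t = (1 + t) ^ β * φ t)
    (hd : ∀ t ∈ Ioo (-1 : ℝ) 1, HasDerivAt v (v' t) t) {t : ℝ} (ht : t ∈ Ioo (-1 : ℝ) 1) :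
    v' t = (1 + t) ^ (β - 1) * (β * φ t + (1 + t) * deriv φ t) := by
  refine (hd t ht).unique ((hasDerivAt_endFactor hφ ht).congr_of_eventuallyEq ?_)
  filter_upwards [isOpen_Ioo.mem_nhds ht] with z hz using hv z hz

lemma EndSmooth.derivative {β : ℝ} {v v' : ℝ → ℝ} (hv : EndSmooth β v)
    (hd : ∀ t ∈ Ioo (-1 : ℝ) 1, HasDerivAt v (v' t) t) : EndSmooth (β - 1) v' := by
  obtain ⟨φ, hφ, hv⟩ := hv
  have hφ' : ContDiffOn ℝ ∞ (deriv φ) (Iio 1) := hφ.deriv_of_isOpen isOpen_Iio (by simp)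
  exact ⟨fun t => β * φ t + (1 + t) * deriv φ t,
    (contDiffOn_const.mul hφ).add (ContDiffOn.mul (by fun_prop) hφ'),
    fun t ht => EndSmooth.hasDerivAt_eq hφ hv hd ht⟩

lemma rlInt_const_mul (ρ c : ℝ) (v : ℝ → ℝ) (x : ℝ) :
    rlInt ρ (fun t => c * v t) x = c * rlInt ρ v x := by
  unfold rlInt
  rw [← intervalIntegral.integral_const_mul]
  congr 1; funext t; ring

lemma rlInt_add {β ρ : ℝ} {v w : ℝ → ℝ} (hv : EndSmooth β v) (hw : EndSmooth β w) (hβ : -1 < β)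
    (hρ : 0 < ρ) {x : ℝ} (hx : x ∈ Ioo (-1 : ℝ) 1) :
    rlInt ρ (fun t => v t + w t) x = rlInt ρ v x + rlInt ρ w x := by
  unfold rlInt
  rw [← intervalIntegral.integral_add (hv.intervalIntegrable hβ hρ hx)
    (hw.intervalIntegrable hβ hρ hx)]
  congr 1; funext t; ring

lemma rlInt_congr {ρ : ℝ} {v w : ℝ → ℝ} (h : ∀ t ∈ Ioo (-1 : ℝ) 1, v t = w t) {x : ℝ}
    (hx : x ∈ Ioo (-1 : ℝ) 1) : rlInt ρ v x = rlInt ρ w x :=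
  intervalIntegral_congr_Ioo hx.1.le fun t ht => by rw [h t ⟨ht.1, ht.2.trans hx.2⟩]

lemma rlInt_id_mul {β ρ : ℝ} {v : ℝ → ℝ} (hv : EndSmooth β v) (hβ : -1 < β)
    (hρ : 0 < ρ) {x : ℝ} (hx : x ∈ Ioo (-1 : ℝ) 1) :
    rlInt ρ (fun t => t * v t) x = x * rlInt ρ v x - rlInt (ρ + 1) v x := by
  unfold rlInt
  rw [← intervalIntegral.integral_const_mul, ← intervalIntegral.integral_sub
    ((hv.intervalIntegrable hβ hρ hx).const_mul x)
    (hv.intervalIntegrable hβ (by linarith : 0 < ρ + 1) hx)]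
  refine intervalIntegral_congr_Ioo hx.1.le fun t ht => ?_
  have : (x - t) ^ (ρ + 1 - 1) = (x - t) ^ (ρ - 1) * (x - t) := by
    rw [← Real.rpow_add_one (by linarith [ht.2] : 0 < x - t).ne']; ring_nf
  rw [this]; ring

/-- Integration by parts. -/
lemma rlInt_succ_derivative {β ρ : ℝ} {v v' : ℝ → ℝ} (hv : EndSmooth β v) (hβ : 0 < β)
    (hρ : 0 < ρ) (hd : ∀ t ∈ Ioo (-1 : ℝ) 1, HasDerivAt v (v' t) t) {x : ℝ}
    (hx : x ∈ Ioo (-1 : ℝ) 1) : rlInt (ρ + 1) v' x = ρ * rlInt ρ v x := by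
  have i1 := (hv.derivative hd).intervalIntegrable (by linarith) (by linarith : 0 < ρ + 1) hx
  have i2 := (hv.intervalIntegrable (by linarith) hρ hx).const_mul ρ
  obtain ⟨φ, hφ, hv⟩ := hv
  -- The primitive uses `(1 + t)^β φ(t)` in place of `v`, whose values are prescribed only on the
  -- open interval. Both boundary terms vanish as `β > 0` and `ρ > 0`.
  have key := intervalIntegral.integral_eq_sub_of_hasDerivAt_of_le hx.1.le
    (f := fun t => (1 + t) ^ β * φ t * (x - t) ^ ρ)
    (f' := fun t => v' t * (x - t) ^ (ρ + 1 - 1) - ρ * (v t * (x - t) ^ (ρ - 1))) ?_ ?_ (i1.sub i2)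
  · rw [intervalIntegral.integral_sub i1 i2, intervalIntegral.integral_const_mul] at key
    simp only [sub_self, Real.zero_rpow hρ.ne', mul_zero, add_neg_cancel, Real.zero_rpow hβ.ne',
      zero_mul] at key
    unfold rlInt
    linarith
  · refine ContinuousOn.mul (ContinuousOn.mul ?_ ?_) ?_
    · exact ContinuousOn.rpow_const (by fun_prop) fun _ _ => Or.inr hβ.le
    · exact hφ.continuousOn.mono fun z hz => hz.2.trans_lt hx.2
    · exact ContinuousOn.rpow_const (by fun_prop) fun _ _ => Or.inr hρ.le
  · intro t ht
    have ht' : t ∈ Ioo (-1 : ℝ) 1 := ⟨ht.1, ht.2.trans hx.2⟩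
    have h1 := hasDerivAt_endFactor (β := β) hφ ht'
    rw [← EndSmooth.hasDerivAt_eq hφ hv hd ht'] at h1
    have h2 : HasDerivAt (fun t : ℝ => (x - t) ^ ρ) (-1 * ρ * (x - t) ^ (ρ - 1)) t :=
      ((hasDerivAt_id t).const_sub x).rpow_const (Or.inl (by simp only [id]; linarith [ht.2]))
    refine (h1.mul h2).congr_deriv ?_
    rw [hv t ht', add_sub_cancel_right]
    ring

/-- The Euler (dilation) formula for the derivative of a fractional integral. -/
lemma hasDerivAt_rlInt_euler {β ρ : ℝ} {v v' : ℝ → ℝ} (hv : EndSmooth β v) (hβ : -1 < β)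
    (hρ : 0 < ρ) (hd : ∀ t ∈ Ioo (-1 : ℝ) 1, HasDerivAt v (v' t) t) {x : ℝ}
    (hx : x ∈ Ioo (-1 : ℝ) 1) :
    HasDerivAt (rlInt ρ v) (rlInt ρ (fun t => ρ * v t + (1 + t) * v' t) x / (1 + x)) x := by
  obtain ⟨φ, hφ, hv⟩ := hv
  have hc : 0 < 1 + x := by linarith [hx.1]
  set g : ℝ → ℝ := fun τ => τ ^ β * (1 - τ) ^ (ρ - 1)
  have hg : IntervalIntegrable g volume 0 1 := intervalIntegrable_unitWeight hβ hρ
  have h1 := hasDerivAt_dilationInt hg hφ hx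
  have h3 : HasDerivAt (fun t : ℝ => (1 + t) ^ (β + ρ)) (1 * (β + ρ) * (1 + x) ^ (β + ρ - 1)) x :=
    ((hasDerivAt_id x).const_add 1).rpow_const (Or.inl hc.ne')
  have h4 := (h3.mul h1).congr_of_eventuallyEq (f₁ := rlInt ρ v) (by
    filter_upwards [isOpen_Ioo.mem_nhds hx] with z hz using rlInt_eq_dilationInt hv hz)
  refine h4.congr_deriv ?_
  have hφ' : ContDiffOn ℝ ∞ (deriv φ) (Iio 1) := hφ.deriv_of_isOpen isOpen_Iio (by simp)
  have h5 : rlInt ρ (fun t => ρ * v t + (1 + t) * v' t) x =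
      (1 + x) ^ (β + ρ) * dilationInt g (fun t => (β + ρ) * φ t + (1 + t) * deriv φ t) x := by
    refine rlInt_eq_dilationInt (fun t ht => ?_) hx
    have hct : 0 < 1 + t := by linarith [ht.1]
    rw [EndSmooth.hasDerivAt_eq hφ hv hd ht, hv t ht]
    have : (1 + t) ^ β = (1 + t) ^ (β - 1) * (1 + t) := by
      rw [← Real.rpow_add_one hct.ne']; ring_nf
    rw [this]; ring
  have h6 : dilationInt g (fun t => (β + ρ) * φ t + (1 + t) * deriv φ t) x =
      (β + ρ) * dilationInt g φ x + (1 + x) * dilationInt (fun τ => g τ * τ) (deriv φ) x := by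
    have hgτ : IntervalIntegrable (fun τ => g τ * τ) volume 0 1 :=
      hg.mul_continuousOn continuousOn_id
    unfold dilationInt
    rw [← intervalIntegral.integral_const_mul, ← intervalIntegral.integral_const_mul,
      ← intervalIntegral.integral_add
        ((intervalIntegrable_dilation hg hφ.continuousOn hx).const_mul _)
        ((intervalIntegrable_dilation hgτ hφ'.continuousOn hx).const_mul _)]
    congr 1; funext τ
    ring
  rw [h5, h6]
  have : (1 + x) ^ (β + ρ) = (1 + x) ^ (β + ρ - 1) * (1 + x) := by
    rw [← Real.rpow_add_one hc.ne']; ring_nf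
  rw [this]
  field_simp

lemma rlInt_one_add_mul {β ρ : ℝ} {v : ℝ → ℝ} (hv : EndSmooth β v) (hβ : -1 < β)
    (hρ : 0 < ρ) {x : ℝ} (hx : x ∈ Ioo (-1 : ℝ) 1) :
    rlInt ρ (fun t => (1 + t) * v t) x = (1 + x) * rlInt ρ v x - rlInt (ρ + 1) v x := by
  have := rlInt_add hv (hv.smooth_mul (q := fun t => t) contDiff_id) hβ hρ hx
  simp only [add_mul, one_mul]
  rw [this, rlInt_id_mul hv hβ hρ hx]
  ring

/-- In the Euler formula, write `1 + t = (1 + x) - (x - t)`. The term with `x - t` is an integral of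
order `ρ + 1`, and integration by parts cancels it against `ρ v`. -/
lemma hasDerivAt_rlInt {β ρ : ℝ} {v v' : ℝ → ℝ} (hv : EndSmooth β v) (hβ : 0 < β)
    (hρ : 0 < ρ) (hd : ∀ t ∈ Ioo (-1 : ℝ) 1, HasDerivAt v (v' t) t) {x : ℝ}
    (hx : x ∈ Ioo (-1 : ℝ) 1) : HasDerivAt (rlInt ρ v) (rlInt ρ v' x) x := by
  have hc : 0 < 1 + x := by linarith [hx.1]
  refine (hasDerivAt_rlInt_euler hv (by linarith) hρ hd hx).congr_deriv ?_
  have hv' := hv.derivative hd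
  have hv1 : EndSmooth β (fun t => (1 + t) * v' t) := by
    obtain ⟨φ, hφ, h⟩ := hv'
    refine ⟨φ, hφ, fun t ht => ?_⟩
    have hct : 0 < 1 + t := by linarith [ht.1]
    have : (1 + t) ^ β = (1 + t) ^ (β - 1) * (1 + t) := by
      rw [← Real.rpow_add_one hct.ne']; ring_nf
    change (1 + t) * v' t = _
    rw [h t ht, this]; ring
  rw [rlInt_add (hv.smooth_mul (q := fun _ => ρ) contDiff_const) hv1 (by linarith) hρ hx,
    rlInt_const_mul, rlInt_one_add_mul hv' (by linarith) hρ hx,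
    rlInt_succ_derivative hv hβ hρ hd hx]
  field_simp
  ring

lemma hasDerivAt_rlInt_succ {β ρ : ℝ} {v v' : ℝ → ℝ} (hv : EndSmooth β v) (hβ : 0 < β)
    (hρ : 0 < ρ) (hd : ∀ t ∈ Ioo (-1 : ℝ) 1, HasDerivAt v (v' t) t) {x : ℝ}
    (hx : x ∈ Ioo (-1 : ℝ) 1) : HasDerivAt (rlInt (ρ + 1) v) (ρ * rlInt ρ v x) x := by
  rw [← rlInt_succ_derivative hv hβ hρ hd hx]
  exact hasDerivAt_rlInt hv hβ (by linarith) hd hx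

/-! ### Jacobi functions and the Riesz potential of the weight -/

lemma one_sub_sq_rpow {t : ℝ} (ht : t ∈ Ioo (-1 : ℝ) 1) (α : ℝ) :
    (1 - t ^ 2) ^ α = (1 + t) ^ α * (1 - t) ^ α := by
  rw [← Real.mul_rpow (by linarith [ht.1]) (by linarith [ht.2])]
  ring_nf

lemma endSmooth_genJacobi (n : ℕ) (α : ℝ) : EndSmooth α (genJacobi n α) := by
  refine ⟨fun t => (1 - t) ^ α * jacobiP n α α t, ContDiffOn.mul ?_
    (contDiff_jacobiP n α α).contDiffOn, fun t ht => ?_⟩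
  · refine ContDiffOn.rpow_const_of_ne (by fun_prop) fun x (hx : x < 1) => ?_
    exact (by linarith : 0 < 1 - x).ne'
  · rw [genJacobi, one_sub_sq_rpow ht]; ring

lemma one_sub_sq_pos {t : ℝ} (ht : t ∈ Ioo (-1 : ℝ) 1) : 0 < 1 - t ^ 2 := by
  nlinarith [ht.1, ht.2]

/-- One step of Rodrigues' formula: the raising identity multiplied by the weight. -/
lemma hasDerivAt_genJacobi (n : ℕ) (α : ℝ) {t : ℝ} (ht : t ∈ Ioo (-1 : ℝ) 1) :
    HasDerivAt (genJacobi n (α + 1)) (-2 * ((n : ℝ) + 1) * genJacobi (n + 1) α t) t := by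
  have h0 := one_sub_sq_pos ht
  have hP := hasDerivAt_jacobiP_sum n (α + 1) t
  have hw : HasDerivAt (fun t : ℝ => (1 - t ^ 2) ^ (α + 1))
      (-(((2 : ℕ) : ℝ) * t ^ (2 - 1)) * (α + 1) * (1 - t ^ 2) ^ (α + 1 - 1)) t :=
    ((hasDerivAt_pow 2 t).const_sub 1).rpow_const (Or.inl h0.ne')
  have := jacobiP_raise n α t _ hP
  refine (hw.mul hP).congr_deriv ?_
  rw [genJacobi, add_sub_cancel_right, Real.rpow_add_one h0.ne']
  push_cast
  linear_combination (1 - t ^ 2) ^ α * this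

lemma genJacobi_neg (n : ℕ) (α t : ℝ) : genJacobi n α (-t) = (-1) ^ n * genJacobi n α t := by
  rw [genJacobi, genJacobi, jacobiP_neg, neg_sq]; ring

/-- The weight `(1 - t²)^α`. -/
lemma genJacobi_zero (α t : ℝ) : genJacobi 0 α t = (1 - t ^ 2) ^ α := by
  rw [genJacobi, jacobiP_zero, mul_one]

lemma hasDerivAt_genJacobi' (n : ℕ) (α : ℝ) {t : ℝ} (ht : t ∈ Ioo (-1 : ℝ) 1) :
    HasDerivAt (genJacobi n α) (-2 * ((n : ℝ) + 1) * genJacobi (n + 1) (α - 1) t) t := by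
  have := hasDerivAt_genJacobi n (α - 1) ht
  rwa [sub_add_cancel] at this

/-- Integration by parts of the derivative of `(1 - t²)^(α+1)`, which is `-2(α + 1) t (1 - t²)^α`,
with powers of `t` expanded around `x`. As each order is, up to a constant, the derivative of the
next, this is a second-order ODE. -/
lemma rlInt_weight_recurrence {α σ : ℝ} (hα : 0 < α) (hσ : 0 < σ) {x : ℝ}
    (hx : x ∈ Ioo (-1 : ℝ) 1) :
    σ * (1 - x ^ 2) * rlInt σ (genJacobi 0 α) x +
      (2 * α + 2 * σ + 2) * x * rlInt (σ + 1) (genJacobi 0 α) x -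
      (2 * α + σ + 2) * rlInt (σ + 1 + 1) (genJacobi 0 α) x = 0 := by
  set w := genJacobi 0 α
  have hw : EndSmooth α w := endSmooth_genJacobi 0 α
  have hα1 : -1 < α := by linarith
  have hσ1 : 0 < σ + 1 := by linarith
  have htw : EndSmooth α (fun t => t * w t) := hw.smooth_mul (q := fun t => t) contDiff_id
  have httw : EndSmooth α (fun t => t * (t * w t)) := htw.smooth_mul (q := fun t => t) contDiff_id
  have e1 : ∀ t ∈ Ioo (-1 : ℝ) 1, genJacobi 0 (α + 1) t = w t + (-1) * (t * (t * w t)) := by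
    intro t ht
    simp only [w, genJacobi_zero]
    rw [Real.rpow_add_one (one_sub_sq_pos ht).ne']
    ring
  have e2 : ∀ t ∈ Ioo (-1 : ℝ) 1,
      -2 * (((0 : ℕ) : ℝ) + 1) * genJacobi (0 + 1) α t = -2 * (α + 1) * (t * w t) := by
    intro t ht
    -- The raising identity at `n = 0` gives `P_1^{α,α}(t) = (α + 1) t`.
    have h := jacobiP_raise 0 α t 0 ((hasDerivAt_const t (1 : ℝ)).congr_of_eventuallyEq
      (Eventually.of_forall fun z => jacobiP_zero (α + 1) (α + 1) z))
    rw [jacobiP_zero] at h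
    simp only [w, genJacobi]
    rw [jacobiP_zero]
    linear_combination (-(1 - t ^ 2) ^ α) * h
  have key := rlInt_succ_derivative (endSmooth_genJacobi 0 (α + 1)) (by linarith) hσ
    (fun t ht => hasDerivAt_genJacobi 0 α ht) hx
  rw [rlInt_congr e1 hx, rlInt_congr e2 hx, rlInt_const_mul, rlInt_id_mul hw hα1 hσ1 hx,
    rlInt_add hw (httw.smooth_mul (q := fun _ => -1) contDiff_const) hα1 hσ hx, rlInt_const_mul,
    rlInt_id_mul htw hα1 hσ hx, rlInt_id_mul hw hα1 hσ hx, rlInt_id_mul hw hα1 hσ1 hx] at key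
  linear_combination -key

lemma integral_betaWeight {a b : ℝ} (ha : 0 < a) (hb : 0 < b) :
    ∫ u in (0 : ℝ)..1, u ^ (a - 1) * (1 - u) ^ (b - 1) =
      Real.Gamma a * Real.Gamma b / Real.Gamma (a + b) := by
  have h := ProbabilityTheory.beta_eq_betaIntegralReal a b ha hb
  have h2 : Complex.betaIntegral a b =
      ((∫ u in (0 : ℝ)..1, u ^ (a - 1) * (1 - u) ^ (b - 1) : ℝ) : ℂ) := by
    rw [Complex.betaIntegral, ← intervalIntegral.integral_ofReal]
    refine intervalIntegral.integral_congr fun u hu => ?_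
    rw [uIcc_of_le zero_le_one] at hu
    rw [Complex.ofReal_mul, Complex.ofReal_cpow hu.1, Complex.ofReal_cpow (sub_nonneg.2 hu.2)]
    push_cast
    rfl
  rw [h2, Complex.ofReal_re] at h
  rw [← h, ProbabilityTheory.beta]

lemma rlInt_weight_zero {α ρ : ℝ} (hα : -1 < α) (hρ : 0 < ρ) :
    2 * rlInt ρ (genJacobi 0 α) 0 =
      Real.Gamma (ρ / 2) * Real.Gamma (α + 1) / Real.Gamma (α + 1 + ρ / 2) := by
  have e0 : rlInt ρ (genJacobi 0 α) 0 = ∫ t in (0 : ℝ)..1, (1 - t ^ 2) ^ α * t ^ (ρ - 1) := by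
    have := intervalIntegral.integral_comp_neg (a := 0) (b := 1)
      (fun t => genJacobi 0 α t * (0 - t) ^ (ρ - 1))
    rw [neg_zero] at this
    rw [rlInt, ← this]
    simp only [genJacobi_zero, neg_sq, sub_neg_eq_add, zero_add]
  -- The substitution `u = t²` produces a Beta integral.
  have e1 := intervalIntegral.integral_comp_mul_deriv_of_deriv_nonneg (a := 0) (b := 1)
    (f := fun t => t ^ 2) (f' := fun t => ((2 : ℕ) : ℝ) * t ^ (2 - 1))
    (g := fun u : ℝ => u ^ (ρ / 2 - 1) * (1 - u) ^ (α + 1 - 1)) (by fun_prop)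
    (fun t _ => hasDerivAt_pow 2 t) (fun t ht => by
      have : 0 < t := by simpa using ht.1
      positivity)
  rw [zero_pow two_ne_zero, one_pow, integral_betaWeight (by linarith) (by linarith),
    add_comm (ρ / 2)] at e1
  rw [← e1, e0, ← intervalIntegral.integral_const_mul]
  refine intervalIntegral_congr_Ioo zero_le_one fun t ht => ?_
  have h1 : (t ^ 2) ^ (ρ / 2 - 1) * t = t ^ (ρ - 1) := by
    rw [← Real.rpow_natCast, ← Real.rpow_mul ht.1.le, ← Real.rpow_add_one ht.1.ne']
    congr 1; push_cast; ring
  simp only [Function.comp, Nat.add_one_sub_one, pow_one, Nat.cast_ofNat, add_sub_cancel_right]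
  rw [← h1]
  ring

/-- The Riesz potential of the weight `(1 - t²)^α` is a hypergeometric function. -/
lemma rieszPotential_weight {α ρ : ℝ} (hα : 0 < α) (hρ : 2 < ρ) {x : ℝ}
    (hx : x ∈ Ioo (-1 : ℝ) 1) :
    rlInt ρ (genJacobi 0 α) x + rlInt ρ (genJacobi 0 α) (-x) =
      Real.Gamma (ρ / 2) * Real.Gamma (α + 1) / Real.Gamma (α + 1 + ρ / 2) *
        egf (hyperSeq (-2 * α - ρ) (1 - ρ)) x := by
  obtain ⟨σ, rfl⟩ : ∃ σ, ρ = σ + 1 + 1 := ⟨ρ - 2, by ring⟩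
  have hσ : 0 < σ := by linarith
  set w := genJacobi 0 α
  have hw : EndSmooth α w := endSmooth_genJacobi 0 α
  have hneg : ∀ x ∈ Ioo (-1 : ℝ) 1, -x ∈ Ioo (-1 : ℝ) 1 := fun x hx =>
    ⟨by linarith [hx.2], by linarith [hx.1]⟩
  have d : ∀ τ, 0 < τ → ∀ x ∈ Ioo (-1 : ℝ) 1, HasDerivAt (rlInt (τ + 1) w) (τ * rlInt τ w x) x :=
    fun τ hτ x hx => hasDerivAt_rlInt_succ hw hα hτ (fun t ht => hasDerivAt_genJacobi' 0 α ht) hx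
  have dn : ∀ τ, 0 < τ → ∀ x ∈ Ioo (-1 : ℝ) 1,
      HasDerivAt (fun x => rlInt (τ + 1) w (-x)) (τ * rlInt τ w (-x) * -1) x :=
    fun τ hτ x hx => (d τ hτ (-x) (hneg x hx)).comp x (hasDerivAt_neg x)
  have key := eq_egf_hyperSeq (-2 * α - (σ + 1 + 1)) (1 - (σ + 1 + 1))
    (fun x => rlInt (σ + 1 + 1) w x + rlInt (σ + 1 + 1) w (-x))
    (fun x => (σ + 1) * (rlInt (σ + 1) w x - rlInt (σ + 1) w (-x)))
    (fun x => (σ + 1) * (σ * (rlInt σ w x + rlInt σ w (-x))))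
    (fun x hx => ((d (σ + 1) (by linarith) x hx).add (dn (σ + 1) (by linarith) x hx)).congr_deriv
      (by ring))
    (fun x hx => (((d σ hσ x hx).sub (dn σ hσ x hx)).const_mul (σ + 1)).congr_deriv (by ring))
    (fun x hx => by
      have r1 := rlInt_weight_recurrence hα hσ hx
      have r2 := rlInt_weight_recurrence hα hσ (hneg x hx)
      linear_combination (σ + 1) * r1 + (σ + 1) * r2)
    (by simp) x hx
  simp only [neg_zero] at key
  rw [key, ← rlInt_weight_zero (by linarith) (by linarith)]
  ring

/-! ### Gamma-function evaluation of the normalizing constant -/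

/-- The even terms are products of two Pochhammer symbols with step `2`. The non-vanishing
conditions are those needed by the functional equation of Gamma. -/
lemma hyperSeq_eq_Gamma {α ρ : ℝ} (j : ℕ) (h1 : ∀ i < j, α + ρ / 2 - i ≠ 0)
    (h2 : ∀ i < j, (1 - ρ) / 2 + i ≠ 0) :
    hyperSeq (-2 * α - ρ) (1 - ρ) (2 * j) * Real.Gamma ((1 - ρ) / 2) *
        Real.Gamma (α + 1 + ρ / 2 - j) =
      (-1) ^ j * 4 ^ j * Real.Gamma ((1 - ρ) / 2 + j) * Real.Gamma (α + 1 + ρ / 2) := by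
  induction j with
  | zero => simp [hyperSeq]
  | succ j ih =>
    have ih := ih (fun i hi => h1 i (by omega)) (fun i hi => h2 i (by omega))
    have g1 := Real.Gamma_add_one (h1 j (by omega))
    have g2 := Real.Gamma_add_one (h2 j (by omega))
    rw [show α + ρ / 2 - j + 1 = α + 1 + ρ / 2 - j by ring] at g1
    rw [show 2 * (j + 1) = 2 * j + 2 by ring, hyperSeq]
    push_cast
    rw [show α + 1 + ρ / 2 - ((j : ℝ) + 1) = α + ρ / 2 - j by ring, ← add_assoc, g2,
      pow_succ, pow_succ]
    rw [g1] at ih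
    linear_combination (-4 * ((1 - ρ) / 2 + j)) * ih

lemma cos_ne_zero_of_not_isOddOrder {r : ℝ} (hr0 : 0 ≤ r) (hr : ¬ IsOddOrder r) :
    Real.cos (Real.pi * r / 2) ≠ 0 := by
  intro h
  rw [Real.cos_eq_zero_iff] at h
  obtain ⟨k, hk⟩ := h
  have hk' : r = 2 * k + 1 := by
    have := Real.pi_ne_zero
    field_simp at hk
    linarith
  apply hr
  have hk0 : 0 ≤ k := by
    by_contra hneg
    have : k ≤ -1 := by omega
    have : (k : ℝ) ≤ -1 := by exact_mod_cast this
    linarith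
  lift k to ℕ using hk0
  exact ⟨k, by simpa using hk'⟩

/-- The normalizing constant of the Riesz derivative of the weight `(1 - t²)^α`. -/
lemma riesz_constant {α r : ℝ} (h : ℕ) (hr0 : 0 ≤ r) (hr : ¬ IsOddOrder r)
    (hρ : 0 < 2 * (h : ℝ) - r) (hα : r < 2 * α + 2) :
    1 / (2 * Real.cos (Real.pi * r / 2)) *
      (1 / Real.Gamma (2 * h - r) *
        (Real.Gamma ((2 * h - r) / 2) * Real.Gamma (α + 1) /
          Real.Gamma (α + 1 + (2 * h - r) / 2)) *
        hyperSeq (-2 * α - (2 * h - r)) (1 - (2 * h - r)) (2 * h)) =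
      2 ^ r * Real.Gamma (α + 1) * Real.Gamma ((1 + r) / 2) /
        (√Real.pi * Real.Gamma (α + 1 - r / 2)) := by
  set ρ := 2 * (h : ℝ) - r with hρdef
  have hr' : r = 2 * h - ρ := by rw [hρdef]; ring
  have hcos := cos_ne_zero_of_not_isOddOrder hr0 hr
  have e1 : Real.cos (Real.pi * r / 2) = (-1) ^ h * Real.cos (Real.pi * ρ / 2) := by
    rw [hr', show Real.pi * (2 * h - ρ) / 2 = h * Real.pi - Real.pi * ρ / 2 by ring,
      Real.cos_nat_mul_pi_sub]
  have e2 := hyperSeq_eq_Gamma (α := α) (ρ := ρ) h (fun i hi => by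
      have : (i : ℝ) + 1 ≤ h := by exact_mod_cast hi
      have : 0 < α + ρ / 2 - i := by rw [hρdef]; linarith
      exact this.ne')
    -- If `(1 - ρ) / 2 + i = 0`, then `r = 2h - ρ` is the odd integer `2(h - i - 1) + 1`.
    (fun i hi h0 => hr ⟨h - i - 1, by
      rw [Nat.cast_sub (by omega), Nat.cast_sub (by omega)]
      push_cast
      linarith⟩)
  rw [show α + 1 + ρ / 2 - h = α + 1 - r / 2 by rw [hr']; ring,
    show (1 - ρ) / 2 + h = (1 + r) / 2 by rw [hr']; ring] at e2
  -- Reflection trades the cosine for Gamma values; duplication, in `e4`, then removes `Γ(ρ)`.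
  have e3 := Real.Gamma_mul_Gamma_one_sub ((1 - ρ) / 2)
  rw [show 1 - (1 - ρ) / 2 = ρ / 2 + 1 / 2 by ring,
    show Real.pi * ((1 - ρ) / 2) = Real.pi / 2 - Real.pi * ρ / 2 by ring,
    Real.sin_pi_div_two_sub] at e3
  have e4 := Real.Gamma_mul_Gamma_add_half (ρ / 2)
  rw [show 2 * (ρ / 2) = ρ by ring] at e4
  have e5 : (2 : ℝ) ^ (1 - ρ) * 4 ^ h = 2 * 2 ^ r := by
    rw [show (4 : ℝ) = 2 ^ 2 by norm_num, ← pow_mul, ← Real.rpow_natCast, ← Real.rpow_add two_pos,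
      ← Real.rpow_one_add' zero_le_two (by linarith)]
    congr 1
    rw [hr']; push_cast; ring
  have hc0 : Real.cos (Real.pi * ρ / 2) ≠ 0 := fun h0 => hcos (by rw [e1, h0, mul_zero])
  rw [e1]
  have hG : 0 < Real.Gamma (ρ / 2 + 1 / 2) := Real.Gamma_pos_of_pos (by linarith)
  have hGρ : 0 < Real.Gamma ρ := Real.Gamma_pos_of_pos hρ
  have hGα : 0 < Real.Gamma (α + 1 - r / 2) := Real.Gamma_pos_of_pos (by linarith)
  have hGα2 : 0 < Real.Gamma (α + 1 + ρ / 2) := Real.Gamma_pos_of_pos (by linarith)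
  have hπ : √Real.pi * √Real.pi = Real.pi := Real.mul_self_sqrt Real.pi_pos.le
  have hsπ : 0 < √Real.pi := Real.sqrt_pos.2 Real.pi_pos
  set H := hyperSeq (-2 * α - ρ) (1 - ρ) (2 * h)
  set g := Real.Gamma ((1 - ρ) / 2)
  set G := Real.Gamma (ρ / 2 + 1 / 2)
  set c := Real.cos (Real.pi * ρ / 2)
  set A := Real.Gamma (α + 1 - r / 2)
  set B := Real.Gamma (α + 1 + ρ / 2)
  set R := Real.Gamma ((1 + r) / 2)
  set q := Real.Gamma (ρ / 2)
  set s := √Real.pi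
  have hs : ((-1 : ℝ) ^ h) * (-1) ^ h = 1 := by rw [← mul_pow]; simp
  have e3' : g * G * c = s * s := by rw [e3, hπ]; field_simp
  have hsne : ((-1 : ℝ) ^ h) ≠ 0 := by positivity
  have hg : g ≠ 0 := by
    rintro h0
    rw [h0] at e3'
    nlinarith
  rw [div_mul_div_comm, div_mul_eq_mul_div, div_mul_eq_mul_div, mul_div_assoc', one_mul, one_mul,
    div_div, div_eq_div_iff (by positivity) (by positivity)]
  have hfin : g * G * (q * Real.Gamma (α + 1) * H * (s * A)) =
      g * G * (2 ^ r * Real.Gamma (α + 1) * R * (Real.Gamma ρ * B * (2 * ((-1) ^ h * c)))) := by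
    linear_combination (q * G * Real.Gamma (α + 1) * s) * e2 +
      ((-1) ^ h * 4 ^ h * R * B * Real.Gamma (α + 1) * s) * e4 +
      ((-1) ^ h * R * B * Real.Gamma (α + 1) * s * s * Real.Gamma ρ) * e5 -
      (2 ^ r * Real.Gamma (α + 1) * R * Real.Gamma ρ * B * 2 * (-1) ^ h) * e3'
  have := mul_left_cancel₀ (mul_ne_zero hg hG.ne') hfin
  linear_combination this

/-! ### Reduction of the Riesz derivative to the weight -/

lemma neg_mem_unitInterval {x : ℝ} (hx : x ∈ Ioo (-1 : ℝ) 1) : -x ∈ Ioo (-1 : ℝ) 1 :=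
  ⟨by linarith [hx.2], by linarith [hx.1]⟩

/-- The constant in Rodrigues' formula. -/
def rodriguesConst (n : ℕ) : ℝ := (-1) ^ n / (2 ^ n * n.factorial)

/-- Rodrigues' formula under the integral. Each step differentiates a function with endpoint
exponent `α + 1 > 0`, so `α > -1` suffices. -/
lemma rlInt_genJacobi (n : ℕ) : ∀ {α ρ : ℝ}, -1 < α → 0 < ρ → ∀ x ∈ Ioo (-1 : ℝ) 1,
    rlInt ρ (genJacobi n α) x =
      rodriguesConst n * iteratedDeriv n (rlInt ρ (genJacobi 0 (α + n))) x := by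
  induction n with
  | zero => intro α ρ _ _ x _; simp [rodriguesConst]
  | succ n ih =>
    intro α ρ hα hρ x hx
    have h1 := hasDerivAt_rlInt (endSmooth_genJacobi n (α + 1)) (by linarith) hρ
      (fun t ht => hasDerivAt_genJacobi n α ht) hx
    rw [rlInt_const_mul] at h1
    have h2 : rlInt ρ (genJacobi n (α + 1)) =ᶠ[𝓝 x] fun y =>
        rodriguesConst n * iteratedDeriv n (rlInt ρ (genJacobi 0 (α + 1 + n))) y := by
      filter_upwards [isOpen_Ioo.mem_nhds hx] with y hy using ih (by linarith) hρ y hy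
    have h3 := h2.deriv_eq
    rw [h1.deriv, deriv_const_mul_field, ← iteratedDeriv_succ] at h3
    rw [show α + ((n + 1 : ℕ) : ℝ) = α + 1 + n by push_cast; ring]
    have hn : (n : ℝ) + 1 ≠ 0 := by positivity
    have h4 : rodriguesConst (n + 1) * (-2 * ((n : ℝ) + 1)) = rodriguesConst n := by
      unfold rodriguesConst
      rw [Nat.factorial_succ, pow_succ, pow_succ]
      push_cast
      field_simp
    rw [← h4] at h3
    have h5 : -2 * ((n : ℝ) + 1) ≠ 0 := mul_ne_zero (by norm_num) hn
    apply mul_left_cancel₀ h5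
    linear_combination h3

lemma leftFracInt_eq_rlInt (ρ : ℝ) (v : ℝ → ℝ) {x : ℝ} (hx : x ∈ Ioo (-1 : ℝ) 1) :
    leftFracInt ρ v x = 1 / Real.Gamma ρ * rlInt ρ v x := by
  unfold leftFracInt rlInt
  congr 1
  refine intervalIntegral_congr_Ioo hx.1.le fun t ht => ?_
  rw [leftKernel, div_eq_mul_inv, ← Real.rpow_neg (by linarith [ht.2]), neg_sub]

lemma rightFracInt_eq_leftFracInt (ρ : ℝ) (v : ℝ → ℝ) (x : ℝ) :
    rightFracInt ρ v x = leftFracInt ρ (fun t => v (-t)) (-x) := by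
  unfold rightFracInt leftFracInt
  have := intervalIntegral.integral_comp_neg (a := -1) (b := -x) (rightKernel ρ v x)
  rw [neg_neg, neg_neg] at this
  rw [← this]
  congr 2
  funext t
  rw [rightKernel, leftKernel, show -t - x = -x - t by ring]

lemma leftFracInt_const_mul (ρ c : ℝ) (v : ℝ → ℝ) (x : ℝ) :
    leftFracInt ρ (fun t => c * v t) x = c * leftFracInt ρ v x := by
  have : leftKernel ρ (fun t => c * v t) x = fun t => c * leftKernel ρ v x t := by
    funext t; simp only [leftKernel]; ring
  rw [leftFracInt, this, intervalIntegral.integral_const_mul, leftFracInt]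
  ring

lemma rightFracInt_genJacobi (ρ : ℝ) (n : ℕ) (α : ℝ) :
    rightFracInt ρ (genJacobi n α) = fun x => (-1) ^ n * leftFracInt ρ (genJacobi n α) (-x) := by
  funext x
  rw [rightFracInt_eq_leftFracInt, ← leftFracInt_const_mul]
  simp only [genJacobi_neg]

lemma EndSmooth.contDiffAt_leftFracInt {β ρ : ℝ} {v : ℝ → ℝ} (hv : EndSmooth β v) (hβ : -1 < β)
    (hρ : 0 < ρ) (n : ℕ) {x : ℝ} (hx : x ∈ Ioo (-1 : ℝ) 1) :
    ContDiffAt ℝ n (leftFracInt ρ v) x := by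
  have h := (hv.contDiffOn_rlInt hβ hρ n).contDiffAt (isOpen_Ioo.mem_nhds hx)
  refine (contDiffAt_const.mul h).congr_of_eventuallyEq
    (f := fun x => 1 / Real.Gamma ρ * rlInt ρ v x) ?_
  filter_upwards [isOpen_Ioo.mem_nhds hx] with y hy using leftFracInt_eq_rlInt ρ v hy

lemma ceilOrder_sub_pos (r : ℝ) : 0 < (ceilOrder r : ℝ) - r := by
  have := Nat.lt_floor_add_one r
  unfold ceilOrder
  push_cast
  linarith

lemma EndSmooth.intervalIntegrable_leftKernel {β ρ : ℝ} {v : ℝ → ℝ} (hv : EndSmooth β v)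
    (hβ : -1 < β) (hρ : 0 < ρ) {x : ℝ} (hx : x ∈ Ioo (-1 : ℝ) 1) :
    IntervalIntegrable (leftKernel ρ v x) volume (-1) x := by
  refine intervalIntegrable_congr_Ioo hx.1.le (fun t ht => ?_) (hv.intervalIntegrable hβ hρ hx)
  rw [leftKernel, div_eq_mul_inv, ← Real.rpow_neg (by linarith [ht.2]), neg_sub]

lemma rlDefinedAt_genJacobi (n : ℕ) {α : ℝ} (hα : -1 < α) (r : ℝ) {x : ℝ}
    (hx : x ∈ Ioo (-1 : ℝ) 1) : RLDefinedAt r (genJacobi n α) x := by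
  have hv := endSmooth_genJacobi n α
  have hρ := ceilOrder_sub_pos r
  refine ⟨fun y hy => ⟨hv.intervalIntegrable_leftKernel hα hρ hy, ?_⟩,
    hv.contDiffAt_leftFracInt hα hρ _ hx, ?_⟩
  · have := ((hv.intervalIntegrable_leftKernel hα hρ (neg_mem_unitInterval hy)).comp_sub_left
      0).symm.const_mul ((-1) ^ n)
    rw [sub_neg_eq_add, zero_add, sub_neg_eq_add, zero_add] at this
    convert this using 1
    funext t
    rw [rightKernel, leftKernel, zero_sub, genJacobi_neg, show -y - -t = t - y by ring,
      ← mul_div_assoc, ← mul_assoc, ← mul_pow]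
    simp
  · rw [rightFracInt_genJacobi]
    exact contDiffAt_const.mul
      ((hv.contDiffAt_leftFracInt hα hρ _ (neg_mem_unitInterval hx)).comp x contDiff_neg.contDiffAt)

lemma hasDerivAt_leftFracInt_weight {β τ : ℝ} (hβ : 0 < β) (hτ : 0 < τ) {x : ℝ}
    (hx : x ∈ Ioo (-1 : ℝ) 1) :
    HasDerivAt (leftFracInt (τ + 1) (genJacobi 0 β)) (leftFracInt τ (genJacobi 0 β) x) x := by
  have h := (hasDerivAt_rlInt_succ (endSmooth_genJacobi 0 β) hβ hτ
    (fun t ht => hasDerivAt_genJacobi' 0 β ht) hx).const_mul (1 / Real.Gamma (τ + 1))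
  refine (h.congr_of_eventuallyEq ?_).congr_deriv ?_
  · filter_upwards [isOpen_Ioo.mem_nhds hx] with y hy using leftFracInt_eq_rlInt _ _ hy
  · rw [leftFracInt_eq_rlInt _ _ hx, Real.Gamma_add_one hτ.ne']
    have := (Real.Gamma_pos_of_pos hτ).ne'
    field_simp

lemma iteratedDeriv_leftFracInt_weight {β τ : ℝ} (hβ : 0 < β) (hτ : 0 < τ) (j : ℕ) :
    EqOn (iteratedDeriv j (leftFracInt (τ + j) (genJacobi 0 β))) (leftFracInt τ (genJacobi 0 β))
      (Ioo (-1) 1) := by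
  induction j with
  | zero => intro x _; simp
  | succ j ih =>
    intro x hx
    have h : EqOn (deriv (leftFracInt (τ + j + 1) (genJacobi 0 β)))
        (leftFracInt (τ + j) (genJacobi 0 β)) (Ioo (-1) 1) := fun y hy =>
      (hasDerivAt_leftFracInt_weight hβ (by positivity) hy).deriv
    rw [iteratedDeriv_succ', Nat.cast_succ, ← add_assoc,
      h.iteratedDeriv_of_isOpen isOpen_Ioo j hx, ih hx]

lemma iteratedDeriv_iteratedDeriv (m n : ℕ) (f : ℝ → ℝ) :
    iteratedDeriv m (iteratedDeriv n f) = iteratedDeriv (m + n) f := by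
  rw [iteratedDeriv_eq_iterate, iteratedDeriv_eq_iterate, iteratedDeriv_eq_iterate,
    Function.iterate_add_apply]

/-- With `m = ceilOrder r`, the order `m - r` is raised by `m + 2` and as many derivatives are
added. The order then exceeds `2`, as the ODE for the potential requires, and apart from the `n` of
Rodrigues' formula the number of derivatives is even. -/
lemma leftRL_genJacobi (n : ℕ) {α : ℝ} (hα : 0 < α) (r : ℝ) {x : ℝ} (hx : x ∈ Ioo (-1 : ℝ) 1) :
    leftRL r (genJacobi n α) x = rodriguesConst n *
      iteratedDeriv (2 * (ceilOrder r + 1) + n)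
        (leftFracInt (2 * ((ceilOrder r + 1 : ℕ) : ℝ) - r) (genJacobi 0 (α + n))) x := by
  set m := ceilOrder r with hm
  have hρ : 0 < (m : ℝ) - r := ceilOrder_sub_pos r
  set w := genJacobi 0 (α + n)
  set ℓ := leftFracInt (2 * ((m + 1 : ℕ) : ℝ) - r) w
  have hβ : 0 < α + n := by positivity
  have e1 : EqOn (leftFracInt ((m : ℝ) - r) w) (iteratedDeriv (m + 2) ℓ) (Ioo (-1) 1) := by
    intro y hy
    have := iteratedDeriv_leftFracInt_weight hβ hρ (m + 2) hy
    rw [show (m : ℝ) - r + ((m + 2 : ℕ) : ℝ) = 2 * ((m + 1 : ℕ) : ℝ) - r by push_cast; ring] at this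
    exact this.symm
  have e2 : EqOn (leftFracInt ((m : ℝ) - r) (genJacobi n α))
      (fun y => rodriguesConst n * iteratedDeriv (n + (m + 2)) ℓ y) (Ioo (-1) 1) := by
    intro y hy
    have h1 : EqOn (leftFracInt ((m : ℝ) - r) w)
        (fun y => 1 / Real.Gamma ((m : ℝ) - r) * rlInt ((m : ℝ) - r) w y) (Ioo (-1) 1) :=
      fun z hz => leftFracInt_eq_rlInt _ _ hz
    simp only
    rw [← iteratedDeriv_iteratedDeriv, ← e1.iteratedDeriv_of_isOpen isOpen_Ioo n hy,
      h1.iteratedDeriv_of_isOpen isOpen_Ioo n hy, iteratedDeriv_const_mul_field,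
      leftFracInt_eq_rlInt _ _ hy, rlInt_genJacobi n (by linarith) hρ y hy]
    ring
  rw [leftRL, ← hm, e2.iteratedDeriv_of_isOpen isOpen_Ioo m hx, iteratedDeriv_const_mul_field,
    iteratedDeriv_iteratedDeriv, show m + (n + (m + 2)) = 2 * (m + 1) + n by ring]

/-- The sign `(-1)^m` in the right derivative cancels the one from the chain rule for `x ↦ -x`,
leaving the parity of the Jacobi function. -/
lemma rightRL_genJacobi (n : ℕ) (α r x : ℝ) :
    rightRL r (genJacobi n α) x = (-1) ^ n * leftRL r (genJacobi n α) (-x) := by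
  rw [rightRL, rightFracInt_genJacobi, iteratedDeriv_const_mul_field, iteratedDeriv_comp_neg,
    leftRL, smul_eq_mul, mul_left_comm ((-1 : ℝ) ^ ceilOrder r), ← mul_assoc ((-1 : ℝ) ^ ceilOrder r),
    ← mul_pow]
  simp

/-- The normalizing constant of the Riesz derivative of order `r` of `(1 - t²)^β`. -/
def rieszConst (β r : ℝ) : ℝ :=
  2 ^ r * Real.Gamma (β + 1) * Real.Gamma ((1 + r) / 2) / (√Real.pi * Real.Gamma (β + 1 - r / 2))

/-- The Riesz derivative of every order that is not an odd integer, as a hypergeometric series. -/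
lemma rieszExpr_genJacobi (n : ℕ) {α r : ℝ} (hα : 0 < α) (hr0 : 0 ≤ r) (hr : ¬ IsOddOrder r)
    (hrα : r < 2 * (α + n) + 2) {x : ℝ} (hx : x ∈ Ioo (-1 : ℝ) 1) :
    rieszExpr r (genJacobi n α) x = (-1) ^ ⌊(r + 1) / 2⌋₊ * (rodriguesConst n *
      rieszConst (α + n) r *
        egf (fun k => hyperSeq (r - 2 * (α + n)) (1 + r) (k + n)) x) := by
  have hm := ceilOrder_sub_pos r
  set m := ceilOrder r
  set h := m + 1 with hh
  set β := α + n with hβdef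
  have hβ : 0 < β := by positivity
  set ρ := 2 * (h : ℝ) - r with hρdef
  have hρ : 2 < ρ := by
    have : (0 : ℝ) ≤ m := by positivity
    rw [hρdef, hh]; push_cast; linarith
  set w := genJacobi 0 β
  have hw : EndSmooth β w := endSmooth_genJacobi 0 β
  set ℓ := leftFracInt ρ w with hℓ
  set B := Real.Gamma (ρ / 2) * Real.Gamma (β + 1) / Real.Gamma (β + 1 + ρ / 2) with hB
  have hx' := neg_mem_unitInterval hx
  have hcd : ∀ N : ℕ, ∀ y ∈ Ioo (-1 : ℝ) 1, ContDiffAt ℝ N ℓ y := fun N y hy =>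
    hw.contDiffAt_leftFracInt (by linarith) (by linarith) N hy
  have e1 : leftRL r (genJacobi n α) x + rightRL r (genJacobi n α) x =
      rodriguesConst n * iteratedDeriv (2 * h + n) (fun y => ℓ y + ℓ (-y)) x := by
    have hadd := iteratedDeriv_fun_add (n := 2 * h + n) (hcd (2 * h + n) x hx)
      ((hcd (2 * h + n) (-x) hx').comp x contDiff_neg.contDiffAt)
    simp only [Function.comp_def] at hadd
    rw [hadd, iteratedDeriv_comp_neg, rightRL_genJacobi, leftRL_genJacobi n hα r hx,
      leftRL_genJacobi n hα r hx', smul_eq_mul, pow_add, pow_mul]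
    simp only [neg_one_sq, one_pow, one_mul]
    ring
  have e2 : EqOn (fun y => ℓ y + ℓ (-y))
      (fun y => 1 / Real.Gamma ρ * B * egf (hyperSeq (-2 * β - ρ) (1 - ρ)) y) (Ioo (-1) 1) := by
    intro y hy
    have := rieszPotential_weight hβ hρ hy
    simp only [hℓ]
    rw [leftFracInt_eq_rlInt _ _ hy, leftFracInt_eq_rlInt _ _ (neg_mem_unitInterval hy), ← mul_add,
      this]
    ring
  have e3 : (fun k => hyperSeq (-2 * β - ρ) (1 - ρ) (k + (2 * h + n))) = fun k =>
      hyperSeq (-2 * β - ρ) (1 - ρ) (2 * h) * hyperSeq (r - 2 * β) (1 + r) (k + n) := by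
    funext k
    rw [show k + (2 * h + n) = k + n + 2 * h by ring, hyperSeq_add,
      show -2 * β - ρ + 2 * h = r - 2 * β by rw [hρdef]; ring,
      show 1 - ρ + 2 * h = 1 + r by rw [hρdef]; ring]
  have e4 := riesz_constant h hr0 hr (by linarith : 0 < 2 * (h : ℝ) - r) hrα
  rw [← hρdef] at e4
  rw [rieszExpr, e1, e2.iteratedDeriv_of_isOpen isOpen_Ioo _ hx, iteratedDeriv_const_mul_field,
    iteratedDeriv_egf (factorialGrowth_hyperSeq _ _) _ hx, e3, egf_const_mul, rieszConst, ← e4]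
  ring

/-- With the cosine gone, odd orders are no longer exceptional; the bounds keep all Gamma arguments
positive. -/
lemma continuousAt_rieszConst {β s : ℝ} (hs : 0 ≤ s) (hβ : s < 2 * β + 2) :
    ContinuousAt (rieszConst β) s := by
  have g : ∀ z : ℝ, 0 < z → ContinuousAt Real.Gamma z := fun z hz =>
    (Real.differentiableAt_Gamma fun m => by
      have : (0 : ℝ) ≤ m := by positivity
      linarith).continuousAt
  have h1 : ContinuousAt (fun r : ℝ => Real.Gamma ((1 + r) / 2)) s :=
    ContinuousAt.comp (f := fun r : ℝ => (1 + r) / 2) (g _ (by linarith)) (by fun_prop)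
  have h2 : ContinuousAt (fun r : ℝ => Real.Gamma (β + 1 - r / 2)) s :=
    ContinuousAt.comp (f := fun r : ℝ => β + 1 - r / 2) (g _ (by linarith)) (by fun_prop)
  have h3 : ContinuousAt (fun r : ℝ => (2 : ℝ) ^ r) s :=
    (Real.continuous_const_rpow two_ne_zero).continuousAt
  have h4 : 0 < Real.Gamma (β + 1 - s / 2) := Real.Gamma_pos_of_pos (by linarith)
  have h5 : 0 < √Real.pi := Real.sqrt_pos.2 Real.pi_pos
  exact ((h3.mul continuousAt_const).mul h1).div (continuousAt_const.mul h2) (by positivity)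

/-! ### Termination of the series and the final value -/

/-- In even degree the polynomial is an even solution of the Gegenbauer equation, which is the
hypergeometric one with these parameters. -/
lemma jacobiP_eq_egf (N : ℕ) (a : ℝ) : ∀ x ∈ Ioo (-1 : ℝ) 1,
    jacobiP (2 * N) a a x =
      jacobiP (2 * N) a a 0 * egf (hyperSeq (-(2 * N)) (2 * N + 2 * a + 1)) x := by
  have hc : ContDiff ℝ ∞ (jacobiP (2 * N) a a) := contDiff_jacobiP _ _ _
  have hd : ∀ z, HasDerivAt (jacobiP (2 * N) a a) (deriv (jacobiP (2 * N) a a) z) z := fun z =>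
    ((hc.differentiable (by simp)) z).hasDerivAt
  have hd2 : ∀ z, HasDerivAt (deriv (jacobiP (2 * N) a a))
      (deriv (deriv (jacobiP (2 * N) a a)) z) z := fun z => by
    have : ContDiff ℝ 1 (deriv (jacobiP (2 * N) a a)) :=
      ((contDiff_succ_iff_deriv (n := 1)).1 (contDiff_jacobiP (2 * N) a a)).2.2
    exact ((this.differentiable (by simp)) z).hasDerivAt
  refine eq_egf_hyperSeq _ _ _ _ _ (fun x _ => hd x) (fun x _ => hd2 x) (fun x _ => ?_) ?_
  · have := jacobiP_ode (2 * N) a x _ _ _ hd rfl (hd2 x)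
    push_cast at this
    linear_combination this
  · have h1 := hd 0
    have h2 : HasDerivAt (jacobiP (2 * N) a a) (deriv (jacobiP (2 * N) a a) 0 * -1) 0 := by
      have h3 : HasDerivAt (jacobiP (2 * N) a a) (deriv (jacobiP (2 * N) a a) 0) (-0) := by
        rwa [neg_zero]
      refine (h3.comp 0 (hasDerivAt_neg 0)).congr_of_eventuallyEq
        (Eventually.of_forall fun z => ?_)
      simp [Function.comp, jacobiP_neg, pow_mul]
    linarith [h1.unique h2]

lemma egf_hyperSeq_terminating (n ν : ℕ) (α : ℝ) {x : ℝ} (hx : x ∈ Ioo (-1 : ℝ) 1) :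
    (ascPochhammer ℝ n).eval (2 * α - 2 * ν + 1) / 2 ^ n *
        jacobiP (n + 2 * ν) (α - 2 * ν) (α - 2 * ν) x =
      (-1) ^ (n + ν) * (ascPochhammer ℝ (n + ν)).eval (α - ν + 1) /
        (4 ^ (n + ν) * (n + ν).factorial) *
      egf (fun k => hyperSeq (2 * α - 2 * ν - 2 * (α + n)) (1 + (2 * α - 2 * ν)) (k + n)) x := by
  have h1 : EqOn (jacobiP (2 * (n + ν)) (α - 2 * ν - n) (α - 2 * ν - n)) (fun x =>
      jacobiP (2 * (n + ν)) (α - 2 * ν - n) (α - 2 * ν - n) 0 *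
        egf (hyperSeq (2 * α - 2 * ν - 2 * (α + n)) (1 + (2 * α - 2 * ν))) x) (Ioo (-1) 1) := by
    intro y hy
    have := jacobiP_eq_egf (n + ν) (α - 2 * ν - n) y hy
    rw [show -(2 * ((n + ν : ℕ) : ℝ)) = 2 * α - 2 * ν - 2 * (α + n) by push_cast; ring,
      show 2 * ((n + ν : ℕ) : ℝ) + 2 * (α - 2 * ν - n) + 1 = 1 + (2 * α - 2 * ν) by
        push_cast; ring] at this
    exact this
  have h2 := h1.iteratedDeriv_of_isOpen isOpen_Ioo n hx
  rw [iteratedDeriv_const_mul_field, iteratedDeriv_egf (factorialGrowth_hyperSeq _ _) n hx,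
    jacobiP_zero_arg, show 2 * (n + ν) = n + 2 * ν + n by ring, iteratedDeriv_jacobiP] at h2
  push_cast at h2
  rw [show (n : ℝ) + 2 * ν + n + 2 * (α - 2 * ν - n) + 1 = 2 * α - 2 * ν + 1 by ring,
    show α - 2 * (ν : ℝ) - n + n = α - 2 * ν by ring,
    show (n : ℝ) + ν + (α - 2 * ν - n) + 1 = α - ν + 1 by ring] at h2
  exact h2

lemma Gamma_add_nat_eq (z : ℝ) (hz : 0 < z) (n : ℕ) :
    Real.Gamma (z + n) = (ascPochhammer ℝ n).eval z * Real.Gamma z := by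
  induction n with
  | zero => simp
  | succ n ih =>
    rw [Nat.cast_succ, ← add_assoc, Real.Gamma_add_one (by positivity), ih,
      ascPochhammer_eval_succ_right]
    ring

lemma riesz_value (α : ℝ) (k ν n : ℕ) (hνα : (ν : ℝ) ≤ α) (hνk : ν ≤ k) {x : ℝ}
    (hx : x ∈ Ioo (-1 : ℝ) 1) :
    (-1) ^ (k - ν) * (rodriguesConst n * rieszConst (α + n) (2 * α - 2 * ν) *
      egf (fun j => hyperSeq (2 * α - 2 * ν - 2 * (α + n)) (1 + (2 * α - 2 * ν)) (j + n)) x) =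
    (-1) ^ k * (2 ^ (2 * ν) * Real.Gamma ((n : ℝ) + 2 * α - 2 * (ν : ℝ) + 1) /
      (n.factorial : ℝ)) * jacobiP (n + 2 * ν) (α - 2 * (ν : ℝ)) (α - 2 * (ν : ℝ)) x := by
  have key := egf_hyperSeq_terminating n ν α hx
  set E := egf (fun j => hyperSeq (2 * α - 2 * ν - 2 * (α + n)) (1 + (2 * α - 2 * ν)) (j + n)) x
  set J := jacobiP (n + 2 * ν) (α - 2 * (ν : ℝ)) (α - 2 * (ν : ℝ)) x
  have g1 := Gamma_add_nat_eq (2 * α - 2 * ν + 1) (by linarith) n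
  have g2 := Gamma_add_nat_eq (α - ν + 1) (by linarith) (n + ν)
  -- Duplication merges the two half-step Gamma factors into `Γ(2α - 2ν + 1)`, cancelling `√π` and
  -- the real power of `2`.
  have g3 := Real.Gamma_mul_Gamma_add_half ((1 + (2 * α - 2 * ν)) / 2)
  rw [show 2 * α - 2 * (ν : ℝ) + 1 + n = n + 2 * α - 2 * ν + 1 by ring] at g1
  rw [show α - (ν : ℝ) + 1 + ((n + ν : ℕ) : ℝ) = α + n + 1 by push_cast; ring] at g2
  rw [show (1 + (2 * α - 2 * (ν : ℝ))) / 2 + 1 / 2 = α - ν + 1 by ring,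
    show 2 * ((1 + (2 * α - 2 * (ν : ℝ))) / 2) = 2 * α - 2 * ν + 1 by ring,
    show 1 - (2 * α - 2 * (ν : ℝ) + 1) = -(2 * α - 2 * ν) by ring,
    Real.rpow_neg zero_le_two] at g3
  have g4 : Real.Gamma (α + n + 1 - (2 * α - 2 * ν) / 2) = (n + ν).factorial := by
    rw [← Real.Gamma_nat_eq_factorial]
    congr 1; push_cast; ring
  have hsg : (-1 : ℝ) ^ k = (-1) ^ (k - ν) * (-1) ^ ν := by
    rw [← pow_add, Nat.sub_add_cancel hνk]
  rw [rieszConst, rodriguesConst, g4, g1, g2, hsg]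
  have p1 : (2 : ℝ) ^ (2 * α - 2 * (ν : ℝ)) ≠ 0 := (Real.rpow_pos_of_pos two_pos _).ne'
  set S := (2 : ℝ) ^ (2 * α - 2 * (ν : ℝ))
  set T := Polynomial.eval (2 * α - 2 * (ν : ℝ) + 1) (ascPochhammer ℝ n)
  set U := Polynomial.eval (α - (ν : ℝ) + 1) (ascPochhammer ℝ (n + ν))
  set G := Real.Gamma (α - ν + 1)
  set H := Real.Gamma ((1 + (2 * α - 2 * (ν : ℝ))) / 2)
  set F : ℝ := ((n + ν).factorial : ℝ)
  have hF : F ≠ 0 := by positivity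
  have hsπ : √Real.pi ≠ 0 := (Real.sqrt_pos.2 Real.pi_pos).ne'
  have e1 : S * H * G = Real.Gamma (2 * α - 2 * ν + 1) * √Real.pi := by
    linear_combination S * g3 +
      Real.Gamma (2 * α - 2 * ν + 1) * √Real.pi * mul_inv_cancel₀ p1
  have hs : ((-1 : ℝ) ^ ν) * (-1) ^ ν = 1 := by rw [← mul_pow]; simp
  have e2 : (-1 : ℝ) ^ n * U * E / F = (-1) ^ ν * 4 ^ (n + ν) * (T / 2 ^ n * J) := by
    rw [key, pow_add (-1 : ℝ)]
    field_simp
    linear_combination (-U * E) * hs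
  calc _ = (-1) ^ (k - ν) * (1 / (2 ^ n * n.factorial)) * (S * H * G) / √Real.pi *
        ((-1 : ℝ) ^ n * U * E / F) := by field_simp
    _ = _ := by
      rw [e1, e2, show (4 : ℝ) = 2 ^ 2 by norm_num, ← pow_mul, mul_add, pow_add, two_mul n, pow_add]
      field_simp

/-- The sign of the Riesz derivative is constant on a right neighbourhood of `2α - 2ν`, which is
what the one-sided limit needs. -/
lemma floor_eq_of_order {α s : ℝ} {k ν : ℕ} (hk₁ : 2 * (k : ℝ) - 1 ≤ 2 * α) (hνk : ν ≤ k)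
    (hs : 2 * α - 2 * ν ≤ s) (hs' : s < 2 * (k : ℝ) + 1 - 2 * ν) : ⌊(s + 1) / 2⌋₊ = k - ν := by
  rw [Nat.floor_eq_iff (by
    have : (ν : ℝ) ≤ k := by exact_mod_cast hνk
    linarith)]
  rw [Nat.cast_sub hνk]
  constructor <;> linarith

end RieszJacobi

end

theorem mainTheorem6 (α : ℝ) (hα : 0 < α) (k : ℕ)
    (hk₁ : 2 * (k : ℝ) - 1 ≤ 2 * α) (hk₂ : 2 * α < 2 * (k : ℝ) + 1)
    (ν : ℕ) (hν : ν ≤ ⌊α⌋₊) (n : ℕ) (x : ℝ) (hx : x ∈ Set.Ioo (-1 : ℝ) 1) :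
    RieszJacobi.HasRieszDerivAt (2 * α - 2 * (ν : ℝ)) (RieszJacobi.genJacobi n α) x
      ((-1) ^ k * (2 ^ (2 * ν) * Real.Gamma ((n : ℝ) + 2 * α - 2 * (ν : ℝ) + 1) /
          (n.factorial : ℝ)) *
        RieszJacobi.jacobiP (n + 2 * ν) (α - 2 * (ν : ℝ)) (α - 2 * (ν : ℝ)) x) := by
  have hνα : (ν : ℝ) ≤ α := (Nat.le_floor_iff hα.le).1 hν
  have hνk : ν ≤ k := by
    have : (ν : ℝ) < k + 1 := by linarith
    have : ν < k + 1 := by exact_mod_cast this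
    omega
  have hn : (0 : ℝ) ≤ n := by positivity
  have hν0 : (0 : ℝ) ≤ ν := by positivity
  have hs0 : 0 ≤ 2 * α - 2 * (ν : ℝ) := by linarith
  rw [← RieszJacobi.riesz_value α k ν n hνα hνk hx]
  refine ⟨fun hodd => ⟨RieszJacobi.rlDefinedAt_genJacobi n (by linarith) _ hx, ?_⟩, fun hodd => ⟨?_, ?_⟩⟩
  · rw [RieszJacobi.rieszExpr_genJacobi n hα hs0 hodd (by linarith) hx,
      RieszJacobi.floor_eq_of_order hk₁ hνk le_rfl (by linarith)]
  · exact Eventually.of_forall fun r => RieszJacobi.rlDefinedAt_genJacobi n (by linarith) r hx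
  · have hcont : ContinuousAt (fun r => (-1 : ℝ) ^ (k - ν) * (RieszJacobi.rodriguesConst n *
        RieszJacobi.rieszConst (α + n) r *
        RieszJacobi.egf (fun j => RieszJacobi.hyperSeq (r - 2 * (α + n)) (1 + r) (j + n)) x))
        (2 * α - 2 * (ν : ℝ)) :=
      continuousAt_const.mul ((continuousAt_const.mul
        (RieszJacobi.continuousAt_rieszConst hs0 (by linarith))).mul
        (RieszJacobi.continuousAt_egf_hyperSeq (by fun_prop) (by fun_prop) n hx _))
    refine (hcont.tendsto.mono_left nhdsWithin_le_nhds).congr' ?_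
    have hlt : 2 * α - 2 * (ν : ℝ) < 2 * (k : ℝ) + 1 - 2 * ν := by linarith
    have hlt2 : 2 * α - 2 * (ν : ℝ) < 2 * (α + n) + 2 := by linarith
    -- The three neighbourhoods fix the sign, keep the Gamma arguments positive, and exclude the
    -- next odd integer, two units to the right.
    filter_upwards [Ioo_mem_nhdsGT hlt, Ioo_mem_nhdsGT hlt2,
      Ioo_mem_nhdsGT (lt_add_of_pos_right (2 * α - 2 * (ν : ℝ)) two_pos)] with r h1 h2 h3
    have hr : ¬ RieszJacobi.IsOddOrder r := by
      rintro ⟨j, hj⟩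
      obtain ⟨i, hi⟩ := hodd
      have hij : (i : ℝ) < j := by linarith [h3.1]
      have hji : (j : ℝ) < i + 1 := by linarith [h3.2]
      norm_cast at hij hji
      omega
    rw [RieszJacobi.rieszExpr_genJacobi n hα (hs0.trans h1.1.le) hr h2.2 hx,
      RieszJacobi.floor_eq_of_order hk₁ hνk h1.1.le h1.2]
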